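/- Let $\widehat{\mathbb C}=\mathbb C\cup\{\infty\}$ be the Riemann sphere. A closed Jordan region is a (compact) subset of $\widehat{\mathbb C}$ homeomorphic to the closed unit disk; for such a set $X$, $\partial X$ denotes its boundary (a Jordan curve) and $\operatorname{int}(X)=X\setminus\partial X$ its interior. Let $U\subset\widehat{\mathbb C}$ be a closed Jordan region and let $f\colon \operatorname{int}(U)\to\mathbb C$ be a holomorphic function that has a continuous extension, again denoted by $f$, to a map $U\to\widehat{\mathbb C}$. Suppose that this extension maps $\partial U$ homeomorphically onto the boundary $\partial V$ of a closed Jordan region $V\subset\widehat{\mathbb C}$ with $\operatorname{int}(V)\subset\mathbb C$. If $\infty\in\partial V$, assume in addition: (i) if $z_0\in\partial U$ is the unique point of $\partial U$ with $f(z_0)=\infty$, then $f$ is injective on $N\cap U$ for some neighborhood $N$ of $z_0$; (ii) if $\partial U$ is oriented so that $U$ lies on the left of $\partial U$ and $\partial V$ carries the orientation induced by $f$, then $V$ lies on the left of $\partial V$. Here a closed Jordan region $X$ lies on the left of its boundary, oriented by a parametrization $\gamma$ by the unit circle (traversed counterclockwise), if for all $a\in\operatorname{int}(X)$ and $b\in\widehat{\mathbb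 C}\setminus X$ the closed curve $\frac{\gamma-a}{\gamma-b}$ in $\mathbb C\setminus\{0\}$ (read as $\frac1{\gamma-b}$ if $a=\infty$, and as $\gamma-a$ if $b=\infty$; its value is $1$ where $\gamma=\infty$) has winding number $1$ around $0$. Then $f$ is a homeomorphism of $U$ onto $V$ that restricts to a biholomorphism between $\operatorname{int}(U)$ and $\operatorname{int}(V)$. -/

import Mathlib

open scoped OnePoint Topology

/-- The Riemann sphere `ℂ ∪ {∞}`, with the topology of the one-point compactification. -/
abbrev RiemannSphere : Type := OnePoint ℂ

namespace RiemannSphere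

noncomputable section

/-- The finite part of a point of the sphere; the value at `∞` is a dummy value. -/
def toComplex (p : RiemannSphere) : ℂ := p.elim 0 id

open Classical in
/-- The inversion `z ↦ 1 / z` of the sphere, which exchanges `0` and `∞`. -/
def inversion (p : RiemannSphere) : RiemannSphere :=
  p.elim ((0 : ℂ) : RiemannSphere) (fun z => if z = 0 then ∞ else ((z⁻¹ : ℂ) : RiemannSphere))

open Classical in
/-- An involution of the sphere that carries `p` to a finite point: the inversion for `p = ∞`,
the identity for finite `p`. The map `toComplex ∘ switch p` is the standard chart at `p`, and
`fun z : ℂ => switch p z` is the inverse of that chart. -/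
def switch (p : RiemannSphere) : RiemannSphere → RiemannSphere :=
  if p = ∞ then inversion else id

/-- `f` is complex differentiable at `p` as a map into the sphere: it is continuous at `p` and its
expression in the standard charts at `p` and at `f p` is complex differentiable. -/
def HolomorphicAt (f : RiemannSphere → RiemannSphere) (p : RiemannSphere) : Prop :=
  ContinuousAt f p ∧
    DifferentiableAt ℂ (fun z : ℂ => toComplex (switch (f p) (f (switch p (z : RiemannSphere)))))
      (toComplex (switch p p))

/-- `f` is holomorphic on `S`. (It is applied to open sets `S` only.) -/
def HolomorphicOn (f : RiemannSphere → RiemannSphere) (S : Set RiemannSphere) : Prop :=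
  ∀ p ∈ S, HolomorphicAt f p

/-- `f` restricts to a homeomorphism of `A` onto `B`. -/
def RestrictsToHomeomorph (f : RiemannSphere → RiemannSphere) (A B : Set RiemannSphere) : Prop :=
  ∃ e : A ≃ₜ B, ∀ z : A, (e z : RiemannSphere) = f z

/-- `f` restricts to a biholomorphism between `A` and `B`: it is a holomorphic bijection of
`A` onto `B` with holomorphic inverse. (It is applied to open sets only.) -/
def RestrictsToBiholomorphism (f : RiemannSphere → RiemannSphere)
    (A B : Set RiemannSphere) : Prop :=
  HolomorphicOn f A ∧ Set.BijOn f A B ∧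
    ∃ g : RiemannSphere → RiemannSphere, Set.InvOn g f A B ∧ HolomorphicOn g B

/-- A closed Jordan region: a subset of the sphere homeomorphic to the closed unit disk. -/
def IsClosedJordanRegion (X : Set RiemannSphere) : Prop :=
  Nonempty (X ≃ₜ Metric.closedBall (0 : ℂ) 1)

/-- The map `g` on the unit circle takes values in `ℂ \ {0}`, and the winding number of
`t ↦ g (exp (i t))`, `0 ≤ t ≤ 2 π`, around the origin is `n`: along a continuous branch of the
logarithm, `log g` increases by `2 π i n`. -/
def HasWindingNumber (g : Circle → ℂ) (n : ℤ) : Prop :=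
  ∃ L : ℝ → ℂ, Continuous L ∧ (∀ t : ℝ, Complex.exp (L t) = g (Circle.exp t)) ∧
    L (2 * Real.pi) - L 0 = 2 * Real.pi * Complex.I * n

open Classical in
/-- The difference `z - a` for finite `z` and `a`, and `1` if one of the two points is `∞`. -/
def diffOrOne (z a : RiemannSphere) : ℂ :=
  if z = ∞ ∨ a = ∞ then 1 else toComplex z - toComplex a

/-- For distinct points `a`, `b` and for `z ≠ b` that is not `∞` if `a` or `b` is `∞`, this is the
value at `z` of the Moebius transformation `(z - a) / (z - b)`, to be read as `1 / (z - b)` if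
`a = ∞` and as `z - a` if `b = ∞`. It sends `a` to `0` and `b` to `∞`. -/
def moebiusQuotient (a b z : RiemannSphere) : ℂ :=
  diffOrOne z a / diffOrOne z b

/-- `γ` is an injective continuous parametrization of `J` by the unit circle. If `J` is a Jordan
curve, this orients it: it is traversed as the unit circle is traversed counterclockwise. -/
def IsJordanParametrization (γ : Circle → RiemannSphere) (J : Set RiemannSphere) : Prop :=
  Continuous γ ∧ Function.Injective γ ∧ Set.range γ = J

/-- The closed Jordan region `X` lies on the left of its boundary, oriented by `γ`: if a Moebius
transformation sends a point `a` of the interior of `X` to `0` and a point `b` outside `X` to `∞`,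
then the image of `γ` winds once counterclockwise around `0`. -/
def LiesOnLeft (X : Set RiemannSphere) (γ : Circle → RiemannSphere) : Prop :=
  IsJordanParametrization γ (frontier X) ∧
    ∀ a ∈ interior X, ∀ b ∉ X, HasWindingNumber (fun s => moebiusQuotient a b (γ s)) 1

end

end RiemannSphere

/-! The proof counts the solutions of `f z = w`. A Möbius change of coordinate moves a point outside
`U` to `∞`, so that `U` becomes a closed topological disk in the plane with positively oriented
boundary. By the argument principle, the number of solutions in `int U`, with multiplicity, is the
winding number of `f(∂U)` about `w`.

If `∞ ∉ V`, the curve `f(∂U)` is `∂V` traversed once in some direction. The count is therefore `±1`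
for `w` in `int V` and `0` for finite `w` outside `V`; a count is not negative, so the sign is plus
(`IsDiskMap.card_fiber_of_infty_notMem`).

If `∞ ∈ ∂V`, only quotients `(f - w) / (f - b)` have a winding number. It is the difference of the
counts for `w` and `b`, and by the orientation hypothesis it equals `1` for `w` in `int V` and `b ∉
V`. Were `b` attained, each `w` in `int V` would have at least two preimages with multiplicity. For
`w` near `∞` they all lie near `z₀`, where `f` is injective, so they form one multiple point and
`f'` vanishes on an open set, which is absurd (`IsDiskMap.card_fiber_of_infty_mem`).

Thus every point of `int V` has exactly one, simple, preimage and no point outside `V` has any; with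
the open mapping theorem this makes `f` conformal from `int U` onto `int V`
(`IsDiskMap.bijOn_of_card`), and the given boundary bijection completes it.

Winding numbers are treated without integrals, as the exponent `n` in `g s = s ^ n * exp (u s)`. In
the argument principle, `f - w` is a product of factors `z - a`, each of degree `1`, and a
nonvanishing function on a disk, of degree `0`. The facts needed about Jordan curves come from the
parametrization by the disk: `mem_interior_image` and `exists_orientation`. -/

namespace RiemannSphere

/-! ### Logarithms and degrees of nonvanishing functions on the circle -/

open unitInterval in
/-- A homotopy of nonvanishing functions carries a continuous logarithm along. -/
theorem exists_log_of_homotopy {A : Type*} [TopologicalSpace A] {H : I × A → ℂ}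
    (hH : Continuous H) (h0 : ∀ x, H x ≠ 0) {u₀ : A → ℂ} (hu₀ : Continuous u₀)
    (h : ∀ a, H (0, a) = Complex.exp (u₀ a)) :
    ∃ u : A → ℂ, Continuous u ∧ ∀ a, H (1, a) = Complex.exp (u a) := by
  -- `exp` is a covering of the punctured plane, so homotopies lift.
  let K : C(I × A, {z : ℂ // z ≠ 0}) := ⟨fun x => ⟨H x, h0 x⟩, by fun_prop⟩
  have hK : ∀ a, K (0, a) = ⟨_, Complex.exp_ne_zero (u₀ a)⟩ := fun a => Subtype.ext (h a)
  refine ⟨fun a => Complex.isCoveringMap_exp.liftHomotopy K ⟨u₀, hu₀⟩ hK (1, a), by fun_prop, ?_⟩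
  intro a
  have := congrFun (Complex.isCoveringMap_exp.liftHomotopy_lifts K ⟨u₀, hu₀⟩ hK) (1, a)
  exact (congrArg Subtype.val this).symm

/-- Contracting the set along segments to a point `x₀` is a homotopy from the constant `q x₀`, which
has a logarithm, to `q`. -/
theorem exists_log_of_convex {E : Type*} [NormedAddCommGroup E] [NormedSpace ℝ E] {s : Set E}
    (hs : Convex ℝ s) {q : E → ℂ} (hq : ContinuousOn q s) (h0 : ∀ x ∈ s, q x ≠ 0) :
    ∃ u : E → ℂ, ContinuousOn u s ∧ ∀ x ∈ s, q x = Complex.exp (u x) := by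
  classical
  rcases s.eq_empty_or_nonempty with rfl | ⟨x₀, hx₀⟩
  · exact ⟨0, by simp, by simp⟩
  have hmem : ∀ y : unitInterval × s, x₀ + (y.1 : ℝ) • ((y.2 : E) - x₀) ∈ s := fun y =>
    hs.add_smul_sub_mem hx₀ y.2.2 y.1.2
  have hc : Continuous fun y : unitInterval × s => q (x₀ + (y.1 : ℝ) • ((y.2 : E) - x₀)) :=
    hq.comp_continuous (by fun_prop) hmem
  obtain ⟨u, hu, hu'⟩ := exists_log_of_homotopy hc (fun y => h0 _ (hmem y))
    (u₀ := fun _ => Complex.log (q x₀)) continuous_const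
    (fun a => by simp [Complex.exp_log (h0 _ hx₀)])
  refine ⟨fun x => if hx : x ∈ s then u ⟨x, hx⟩ else 0, ?_, ?_⟩
  · rw [continuousOn_iff_continuous_domRestrict]
    convert hu using 1
    ext x
    simp
  · intro x hx
    simpa [hx] using hu' ⟨x, hx⟩

theorem int_eq_of_continuous {A : Type*} [TopologicalSpace A] [PreconnectedSpace A] {n : A → ℤ}
    (h : Continuous fun a => (n a : ℂ)) (a b : A) : n a = n b := by
  have h1 : Continuous fun a => (n a : ℝ) := by
    simpa [Function.comp_def] using Complex.continuous_re.comp h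
  have h2 : Continuous n := (Int.isClosedEmbedding_coe_real.isEmbedding.continuous_iff).2 h1
  exact PreconnectedSpace.constant inferInstance h2

/-- The map `g` on the unit circle is `s ↦ s ^ n` times a function with a continuous logarithm. -/
def HasDegree (g : Circle → ℂ) (n : ℤ) : Prop :=
  ∃ u : Circle → ℂ, Continuous u ∧ ∀ s, g s = (s : ℂ) ^ n * Complex.exp (u s)

theorem circle_isQuotientMap_exp : Topology.IsQuotientMap (Circle.exp : ℝ → Circle) :=
  Circle.isCoveringMap_exp.isQuotientMap (fun s => ⟨_, Circle.exp_arg s⟩)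

/-- The increment `L (t + 2π) - L t` is a continuous integer multiple of `2πi`, hence constantly
`2πi n`. So `L t - n t i` is periodic and descends to the circle. -/
theorem HasWindingNumber.hasDegree {g : Circle → ℂ} {n : ℤ} (h : HasWindingNumber g n) :
    HasDegree g n := by
  obtain ⟨L, hL, hLg, hn⟩ := h
  have hex : ∀ t, ∃ k : ℤ, L (t + 2 * Real.pi) - L t = k * (2 * Real.pi * Complex.I) := by
    intro t
    rw [← Complex.exp_eq_one_iff, Complex.exp_sub, hLg, hLg, Circle.exp_add_two_pi]
    rw [← hLg t]; exact div_self (Complex.exp_ne_zero _)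
  choose k hk using hex
  have hpi : (2 * Real.pi * Complex.I : ℂ) ≠ 0 := Complex.two_pi_I_ne_zero
  have hkc : Continuous fun t => (k t : ℂ) := by
    have : (fun t => (k t : ℂ)) =
        fun t => (L (t + 2 * Real.pi) - L t) / (2 * Real.pi * Complex.I) := by
      ext t; rw [hk]; field_simp
    rw [this]
    fun_prop
  have hkn : ∀ t, k t = n := by
    intro t
    rw [int_eq_of_continuous hkc t 0]
    have := hk 0
    rw [zero_add, hn] at this
    have h2 : (n : ℂ) = k 0 := by
      apply mul_left_cancel₀ hpi
      rw [this]; ring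
    exact_mod_cast h2.symm
  have hper : Function.Periodic (fun t : ℝ => L t - n * t * Complex.I) (2 * Real.pi) := by
    intro t
    have := hk t
    rw [hkn] at this
    simp only
    push_cast
    linear_combination this
  have hfac : ∀ a b : ℝ, Circle.exp a = Circle.exp b →
      L a - n * a * Complex.I = L b - n * b * Complex.I := by
    intro a b hab
    obtain ⟨m, rfl⟩ := Circle.exp_eq_exp.1 hab
    have := hper.int_mul m b
    simpa using this
  let P : C(ℝ, ℂ) := ⟨fun t => L t - n * t * Complex.I, by fun_prop⟩
  let Q : Topology.IsQuotientMap (⟨Circle.exp, circle_isQuotientMap_exp.continuous⟩ : C(ℝ, Circle)) :=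
    circle_isQuotientMap_exp
  have hlift : ∀ t, Q.lift P hfac (Circle.exp t) = L t - n * t * Complex.I := fun t =>
    congrArg (fun F : C(ℝ, ℂ) => F t) (Q.lift_comp P hfac)
  refine ⟨Q.lift P hfac, by fun_prop, ?_⟩
  intro s
  obtain ⟨t, rfl⟩ := circle_isQuotientMap_exp.surjective s
  rw [hlift, ← hLg, Circle.coe_exp, ← Complex.exp_int_mul, ← Complex.exp_add]
  congr 1; ring

theorem HasDegree.hasWindingNumber {g : Circle → ℂ} {n : ℤ} (h : HasDegree g n) :
    HasWindingNumber g n := by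
  obtain ⟨u, hu, hg⟩ := h
  refine ⟨fun t => n * t * Complex.I + u (Circle.exp t), by fun_prop, ?_, ?_⟩
  · intro t
    rw [hg, Circle.coe_exp, ← Complex.exp_int_mul, ← Complex.exp_add]
    congr 1; ring
  · simp only [Circle.exp_two_pi, Circle.exp_zero]
    push_cast; ring

theorem exists_hasDegree {g : Circle → ℂ} (hg : Continuous g) (h0 : ∀ s, g s ≠ 0) :
    ∃ n, HasDegree g n := by
  obtain ⟨L, hL, hLg⟩ := exists_log_of_convex (E := ℝ) convex_univ
    (q := fun t => g (Circle.exp t)) (by fun_prop) (fun t _ => h0 _)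
  rw [continuousOn_univ] at hL
  have : Complex.exp (L (2 * Real.pi) - L 0) = 1 := by
    rw [Complex.exp_sub, ← hLg _ trivial, ← hLg _ trivial, Circle.exp_two_pi, Circle.exp_zero]
    exact div_self (h0 _)
  obtain ⟨n, hn⟩ := Complex.exp_eq_one_iff.1 this
  exact ⟨n, HasWindingNumber.hasDegree ⟨L, hL, fun t => (hLg t trivial).symm, by rw [hn]; ring⟩⟩

/-- Two logarithms along the circle differ by a continuous integer multiple of `2πi`, that is, by a
constant, so they have the same total increment. -/
theorem HasDegree.unique {g : Circle → ℂ} {m n : ℤ} (hm : HasDegree g m) (hn : HasDegree g n) :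
    m = n := by
  obtain ⟨L, hL, hLg, hLm⟩ := hm.hasWindingNumber
  obtain ⟨M, hM, hMg, hMn⟩ := hn.hasWindingNumber
  have hex : ∀ t, ∃ k : ℤ, L t - M t = k * (2 * Real.pi * Complex.I) := by
    intro t
    rw [← Complex.exp_eq_one_iff, Complex.exp_sub, hLg, hMg, ← hLg]
    exact div_self (Complex.exp_ne_zero _)
  choose k hk using hex
  have hpi : (2 * Real.pi * Complex.I : ℂ) ≠ 0 := Complex.two_pi_I_ne_zero
  have hkc : Continuous fun t => (k t : ℂ) := by
    have : (fun t => (k t : ℂ)) = fun t => (L t - M t) / (2 * Real.pi * Complex.I) := by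
      ext t; rw [hk]; field_simp
    rw [this]
    fun_prop
  have h1 := hk 0
  have h2 := hk (2 * Real.pi)
  rw [int_eq_of_continuous hkc (2 * Real.pi) 0, ← h1] at h2
  have h3 : (m : ℂ) = n := by
    apply mul_left_cancel₀ hpi
    rw [← hLm, ← hMn]; linear_combination h2
  exact_mod_cast h3

theorem hasDegree_zero {g u : Circle → ℂ} (hu : Continuous u)
    (h : ∀ s, g s = Complex.exp (u s)) : HasDegree g 0 := ⟨u, hu, fun s => by simp [h]⟩

theorem hasDegree_const {c : ℂ} (hc : c ≠ 0) : HasDegree (fun _ => c) 0 :=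
  hasDegree_zero (u := fun _ => Complex.log c) continuous_const
    (fun _ => (Complex.exp_log hc).symm)

theorem hasDegree_coe : HasDegree (fun s => (s : ℂ)) 1 := ⟨0, continuous_const, by simp⟩

theorem hasDegree_inv : HasDegree (fun s => ((s⁻¹ : Circle) : ℂ)) (-1) :=
  ⟨0, continuous_const, by simp⟩

theorem HasDegree.mul {g h : Circle → ℂ} {m n : ℤ} (hg : HasDegree g m) (hh : HasDegree h n) :
    HasDegree (fun s => g s * h s) (m + n) := by
  obtain ⟨u, hu, hug⟩ := hg
  obtain ⟨v, hv, hvh⟩ := hh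
  refine ⟨fun s => u s + v s, by fun_prop, fun s => ?_⟩
  beta_reduce
  rw [hug, hvh, zpow_add₀ s.coe_ne_zero, Complex.exp_add]; ring

theorem HasDegree.congr {g h : Circle → ℂ} {n : ℤ} (hg : HasDegree g n) (e : ∀ s, h s = g s) :
    HasDegree h n := by
  rwa [show h = g from funext e]

theorem HasDegree.const_mul {g : Circle → ℂ} {n : ℤ} (hg : HasDegree g n) {c : ℂ} (hc : c ≠ 0) :
    HasDegree (fun s => c * g s) n := by
  simpa using (hasDegree_const hc).mul hg

theorem HasDegree.comp {g : Circle → ℂ} {σ : Circle → Circle} {m n : ℤ} (hg : HasDegree g n)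
    (hσ : Continuous σ) (hm : HasDegree (fun s => (σ s : ℂ)) m) :
    HasDegree (fun s => g (σ s)) (n * m) := by
  obtain ⟨u, hu, hug⟩ := hg
  obtain ⟨v, hv, hvh⟩ := hm
  refine ⟨fun s => n * v s + u (σ s), by fun_prop, fun s => ?_⟩
  beta_reduce at hvh ⊢
  rw [hug, hvh, mul_zpow, ← zpow_mul, Complex.exp_add, Complex.exp_int_mul, mul_comm n m]; ring

theorem hasDegree_multiset_prod {g : ℂ → Circle → ℂ} {n : ℤ} (M : Multiset ℂ)
    (h : ∀ a ∈ M, HasDegree (g a) n) :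
    HasDegree (fun s => (M.map fun a => g a s).prod) (M.card * n) := by
  induction M using Multiset.induction with
  | empty => simpa using hasDegree_const one_ne_zero
  | cons a M ih =>
    have := (h a (by simp)).mul (ih fun b hb => h b (by simp [hb]))
    simp only [Multiset.map_cons, Multiset.prod_cons, Multiset.card_cons]
    convert this using 1
    push_cast; ring

/-- Dividing by `s ^ n` reduces the claim to carrying a logarithm along a homotopy. -/
theorem HasDegree.homotopy {H : unitInterval × Circle → ℂ} (hH : Continuous H)
    (h0 : ∀ x, H x ≠ 0) {n : ℤ} (hn : HasDegree (fun s => H (0, s)) n) :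
    HasDegree (fun s => H (1, s)) n := by
  obtain ⟨u, hu, hug⟩ := hn
  have hne : ∀ s : Circle, (s : ℂ) ^ n ≠ 0 := fun s => zpow_ne_zero _ s.coe_ne_zero
  have hz : Continuous fun s : Circle => (s : ℂ) ^ n :=
    Continuous.zpow₀ (f := fun s : Circle => (s : ℂ)) (by fun_prop) n fun s => .inl s.coe_ne_zero
  obtain ⟨v, hv, hvg⟩ := exists_log_of_homotopy (H := fun x => H x / (x.2 : ℂ) ^ n)
    (hH.div (hz.comp continuous_snd) fun x => hne x.2)
    (fun x => div_ne_zero (h0 x) (hne x.2)) hu (fun s => by simp [hug, hne s])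
  exact ⟨v, hv, fun s => by rw [← hvg, mul_div_cancel₀ _ (hne s)]⟩

/-- A homeomorphism of the circle has degree `1` or `-1`. -/
theorem hasDegree_homeomorph (σ : Circle ≃ₜ Circle) :
    ∃ m : ℤ, (m = 1 ∨ m = -1) ∧ HasDegree (fun s => (σ s : ℂ)) m := by
  obtain ⟨m, hm⟩ := exists_hasDegree (g := fun s => (σ s : ℂ)) (by fun_prop)
    (fun s => (σ s).coe_ne_zero)
  obtain ⟨k, hk⟩ := exists_hasDegree (g := fun s => (σ.symm s : ℂ)) (by fun_prop)
    (fun s => (σ.symm s).coe_ne_zero)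
  refine ⟨m, ?_, hm⟩
  -- The degrees of `σ` and its inverse multiply to the degree `1` of the identity, so both are
  -- units of `ℤ`.
  have h1 := hm.comp (σ := σ.symm) (by fun_prop) hk
  simp only [Homeomorph.apply_symm_apply] at h1
  exact Int.isUnit_iff.1 (IsUnit.of_mul_eq_one _ (h1.unique hasDegree_coe))

/-! ### Topological disks in the plane: invariance of domain and orientation -/

open Metric Set Filter

theorem coe_circle_mem (s : Circle) : (s : ℂ) ∈ closedBall (0 : ℂ) 1 := by
  simp [Circle.norm_coe]

theorem continuous_coe_circle : Continuous fun s : Circle => (s : ℂ) := by fun_prop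

theorem continuous_circle {X : Type*} [TopologicalSpace X] {f : X → Circle}
    (h : Continuous fun x => (f x : ℂ)) : Continuous f := continuous_induced_rng.2 h

theorem exists_circle_eq {z : ℂ} (hz : ‖z‖ = 1) : ∃ s : Circle, (s : ℂ) = z :=
  ⟨⟨z, by simpa [Submonoid.unitSphere] using hz⟩, rfl⟩

/-- Boundary points of a round disk are extreme points. Since the disk stays convex without them,
nonvanishing functions there still have logarithms. -/
theorem convex_closedBall_sdiff_circle (s : Circle) :
    Convex ℝ (closedBall (0 : ℂ) 1 \ {(s : ℂ)}) :=
  ((convex_closedBall (0 : ℂ) 1).mem_extremePoints_iff_convex_sdiff.1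
    (StrictConvexSpace.sphere_subset_extremePoints_closedBall 0 one_ne_zero
      (mem_sphere_zero_iff_norm.2 (Circle.norm_coe s)))).2

/-- A continuous injection on a compact set has a continuous inverse. -/
theorem continuousOn_invFunOn {X Y : Type*} [TopologicalSpace X] [Nonempty X] [TopologicalSpace Y]
    [T2Space Y] {f : X → Y} {A : Set X} (hA : IsCompact A) (hf : ContinuousOn f A)
    (hi : InjOn f A) : ContinuousOn (Function.invFunOn f A) (f '' A) := by
  have := isCompact_iff_compactSpace.1 hA
  have he : Topology.IsClosedEmbedding (fun x : A => f x) :=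
    Continuous.isClosedEmbedding (continuousOn_iff_continuous_domRestrict.1 hf)
      (fun x y h => Subtype.ext (hi x.2 y.2 h))
  rw [continuousOn_iff_continuous_domRestrict]
  have hmem : ∀ y : f '' A, (y : Y) ∈ range fun x : A => f x := by
    rintro ⟨_, x, hx, rfl⟩
    exact ⟨⟨x, hx⟩, rfl⟩
  have hc : Continuous fun y : f '' A =>
      ((he.isEmbedding.toHomeomorph.symm ⟨y, hmem y⟩ : A) : X) := by fun_prop
  convert hc using 1
  ext ⟨_, x, hx, rfl⟩
  have h1 : he.isEmbedding.toHomeomorph.symm ⟨f x, hmem ⟨f x, x, hx, rfl⟩⟩ = ⟨x, hx⟩ := by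
    rw [Homeomorph.symm_apply_eq]; rfl
  rw [h1]
  exact hi.leftInvOn_invFunOn hx

/-- A nonvanishing function on a convex set has no section over a circle around the origin. -/
theorem no_circle_section {A : Set ℂ} (hA : Convex ℝ A) {q : ℂ → ℂ} (hq : ContinuousOn q A)
    {a : ℂ} (h0 : ∀ x ∈ A, q x ≠ a) {c : Circle → ℂ} (hc : Continuous c) (hcA : ∀ s, c s ∈ A)
    {r : ℂ} (hr : r ≠ 0) (h : ∀ s, q (c s) = a + r * s) : False := by
  obtain ⟨u, hu, huq⟩ := exists_log_of_convex hA (q := fun x => q x - a) (by fun_prop)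
    (fun x hx => sub_ne_zero.2 (h0 x hx))
  have h1 : HasDegree (fun s => r * (s : ℂ)) 0 :=
    hasDegree_zero (u := fun s => u (c s)) (hu.comp_continuous hc hcA)
      (fun s => by rw [← huq _ (hcA s), h]; ring)
  exact absurd (h1.unique (hasDegree_coe.const_mul hr)) (by norm_num)

/-- A nonvanishing function on the part of a closed set `K` on a circle extends to a
nonvanishing function on `K`, if `K` does not contain the center of the circle. -/
theorem exists_nonvanishing_extension {K : Set ℂ} (hK : IsClosed K) {g : ℂ → ℂ}
    (hg : Continuous g) {b : ℂ} {ρ : ℝ} (hρ : 0 < ρ) (hb : b ∉ K)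
    (h0 : ∀ z ∈ K, dist z b = ρ → g z ≠ 0) :
    ∃ G : ℂ → ℂ, ContinuousOn G K ∧ (∀ z ∈ K, G z ≠ 0) ∧ ∀ z ∈ K, dist z b = ρ → G z = g z := by
  have hρ' : (ρ : ℂ) ≠ 0 := by exact_mod_cast hρ.ne'
  set T : Set ℂ := K ∩ sphere b ρ with hT
  have hTc : IsCompact T := (isCompact_sphere b ρ).inter_left hK
  obtain ⟨δ, hδ, hδT⟩ : ∃ δ > 0, ∀ z ∈ T, δ ≤ ‖g z‖ := by
    rcases T.eq_empty_or_nonempty with h | h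
    · exact ⟨1, one_pos, by simp [h]⟩
    · obtain ⟨z, hz, hmin⟩ := hTc.exists_isMinOn h (f := fun z => ‖g z‖) (by fun_prop)
      exact ⟨‖g z‖, norm_pos_iff.2 (h0 z hz.1 hz.2), fun w hw => hmin hw⟩
  obtain ⟨η, hη, hηg, -⟩ := hg.exists_contDiff_approx 1 (ε := fun _ => δ / 2) continuous_const
    (fun _ => by positivity)
  have hcurve : ContDiff ℝ 1 fun t : ℝ => η (b + ρ * Complex.exp (t * Complex.I)) := by
    refine ContDiff.comp (g := η) hη ?_
    have : ContDiff ℝ 1 fun t : ℝ => (t : ℂ) := Complex.ofRealCLM.contDiff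
    fun_prop
  -- A `C¹` curve does not fill any open part of the plane, so an arbitrarily small `c` avoids the
  -- values of `η` on the circle. This is why `g` is first replaced by the smooth `η`.
  obtain ⟨c, hcr, hcδ⟩ := (hcurve.dense_compl_range_of_finrank_lt_finrank
    (by simp [Complex.finrank_real_complex])).exists_dist_lt 0 (show 0 < δ / 2 by positivity)
  have hηc : ∀ s : Circle, η (b + ρ * s) - c ≠ 0 := by
    intro s hs
    refine hcr ⟨Complex.arg s, ?_⟩
    have := Circle.exp_arg s
    rw [← this, Circle.coe_exp] at hs
    exact sub_eq_zero.1 hs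
  have hηcont : Continuous η := hη.continuous
  obtain ⟨m, u, hu, hum⟩ := exists_hasDegree (g := fun s => η (b + ρ * s) - c) (by fun_prop) hηc
  have hcirc : ∀ z ∈ T, ∃ s : Circle, (s : ℂ) = (z - b) / ρ := fun z hz =>
    exists_circle_eq (by
      have : ‖z - b‖ = ρ := by simpa [dist_eq_norm] using hz.2
      rw [norm_div, this, Complex.norm_real, Real.norm_of_nonneg hρ.le, div_self hρ.ne'])
  choose! σ hσ using hcirc
  have hσc : Continuous fun z : T => σ z := by
    apply continuous_circle
    have : (fun z : T => (σ z : ℂ)) = fun z : T => ((z : ℂ) - b) / ρ := by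
      ext z; exact hσ z z.2
    rw [this]; fun_prop
  have hzσ : ∀ z ∈ T, b + ρ * (σ z : ℂ) = z := by
    intro z hz; rw [hσ z hz]; field_simp; ring
  have hgT : ∀ z ∈ T, g z ≠ 0 := fun z hz => h0 z hz.1 hz.2
  -- The errors `η - g` and `c` are each below `δ / 2`, while `‖g‖ ≥ δ` on `T`; so the ratio is
  -- within distance `1` of `1` and has a principal logarithm.
  have hslit : ∀ z ∈ T, (η z - c) / g z ∈ Complex.slitPlane := by
    intro z hz
    have h1 : (η z - c) / g z = 1 + (η z - g z - c) / g z := by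
      field_simp [hgT z hz]; ring
    rw [h1]
    apply Complex.mem_slitPlane_of_norm_lt_one
    rw [norm_div, div_lt_one (norm_pos_iff.2 (hgT z hz))]
    have h2 : ‖η z - g z‖ < δ / 2 := by simpa [dist_eq_norm] using hηg z
    have h3 : ‖c‖ < δ / 2 := by simpa using hcδ
    linarith [norm_sub_le (η z - g z) c, hδT z hz]
  have hvc : Continuous fun z : T => u (σ z) - Complex.log ((η z - c) / g z) := by
    refine (hu.comp hσc).sub (Continuous.clog ?_ fun z => hslit z z.2)
    exact Continuous.div (by fun_prop) (by fun_prop) fun z => hgT z z.2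
  -- On `T`, `g` equals `((z - b) / ρ) ^ m` times an exponential. Tietze extends the exponent, and
  -- the power vanishes at most at `b`, which is not in `K`.
  obtain ⟨V, hV⟩ := ContinuousMap.exists_restrict_eq hTc.isClosed
    (⟨_, hvc⟩ : C(T, ℂ))
  have hVT : ∀ z (hz : z ∈ T), V z = u (σ z) - Complex.log ((η z - c) / g z) := fun z hz =>
    congrArg (fun F : C(T, ℂ) => F ⟨z, hz⟩) hV
  have hzb : ∀ z ∈ K, (z - b) / ρ ≠ 0 := fun z hz =>
    div_ne_zero (sub_ne_zero.2 fun h => hb (h ▸ hz)) hρ'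
  refine ⟨fun z => ((z - b) / ρ) ^ m * Complex.exp (V z), ?_, ?_, ?_⟩
  · exact ContinuousOn.mul (ContinuousOn.zpow₀ (by fun_prop) m fun z hz => .inl (hzb z hz))
      (by fun_prop)
  · exact fun z hz => mul_ne_zero (zpow_ne_zero _ (hzb z hz)) (Complex.exp_ne_zero _)
  · intro z hzK hzb'
    have hz : z ∈ T := ⟨hzK, hzb'⟩
    have h1 := hum (σ z)
    have h2 : η z - c ≠ 0 := by simpa [hzσ z hz] using hηc (σ z)
    beta_reduce at h1
    rw [hzσ z hz] at h1
    beta_reduce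
    rw [hVT z hz, Complex.exp_sub, Complex.exp_log (div_ne_zero h2 (hgT z hz)), ← hσ z hz,
      ← mul_div_assoc, ← h1]
    field_simp [hgT z hz]

/-- In `s - p = s * (1 - p / s)` the second factor has a principal logarithm, because `‖p / s‖ < 1`.
-/
theorem hasDegree_coe_sub {p : ℂ} (hp : ‖p‖ < 1) : HasDegree (fun s => (s : ℂ) - p) 1 := by
  have hslit : ∀ s : Circle, 1 - p / s ∈ Complex.slitPlane := fun s => by
    rw [sub_eq_add_neg]
    apply Complex.mem_slitPlane_of_norm_lt_one
    simpa [Circle.norm_coe] using hp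
  refine ⟨fun s => Complex.log (1 - p / s), Continuous.clog ?_ hslit, fun s => ?_⟩
  · exact continuous_const.sub (Continuous.div continuous_const (by fun_prop)
      fun s => s.coe_ne_zero)
  · rw [Complex.exp_log (Complex.slitPlane_ne_zero (hslit s))]
    have := s.coe_ne_zero
    field_simp

/-- Invariance of domain for the closed disk in the plane. -/
theorem mem_interior_image {q : ℂ → ℂ} (hq : ContinuousOn q (closedBall 0 1))
    (hi : InjOn q (closedBall 0 1)) {p : ℂ} (hp : p ∈ ball (0 : ℂ) 1) :
    q p ∈ interior (q '' closedBall 0 1) := by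
  classical
  by_contra hint
  set K := q '' closedBall 0 1 with hKdef
  have hK : IsCompact K := (isCompact_closedBall 0 1).image_of_continuousOn hq
  have hpc : p ∈ closedBall (0 : ℂ) 1 := ball_subset_closedBall hp
  have hS : IsCompact (q '' sphere 0 1) :=
    (isCompact_sphere 0 1).image_of_continuousOn (hq.mono sphere_subset_closedBall)
  have hpS : q p ∉ q '' sphere 0 1 := by
    rintro ⟨x, hx, hxp⟩
    rw [hi (sphere_subset_closedBall hx) hpc hxp] at hx
    simp at hp hx; linarith
  obtain ⟨ε, hε, hεS⟩ : ∃ ε > 0, ball (q p) ε ⊆ (q '' sphere 0 1)ᶜ :=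
    Metric.isOpen_iff.1 hS.isClosed.isOpen_compl _ hpS
  -- The closed disk of radius `ε / 2` about `b` contains `q p` but misses the image of the unit
  -- circle.
  obtain ⟨b, hbK, hbp⟩ : ∃ b ∉ K, dist (q p) b < ε / 2 := by
    rw [← mem_compl_iff, ← closure_compl, Metric.mem_closure_iff] at hint
    exact hint _ (by positivity)
  have hSb : ∀ x ∈ sphere (0 : ℂ) 1, ε / 2 < dist (q x) b := by
    intro x hx
    by_contra! hle
    refine hεS (a := q x) ?_ ⟨x, hx, rfl⟩
    rw [mem_ball]
    linarith [dist_triangle_right (q x) (q p) b]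
  -- A Tietze extension of `q⁻¹ - p`, whose only zero on `K` is `q p`.
  obtain ⟨g, hg⟩ := ContinuousMap.exists_restrict_eq hK.isClosed
    (⟨_, continuousOn_iff_continuous_domRestrict.1
      ((continuousOn_invFunOn (isCompact_closedBall 0 1) hq hi).sub
        (continuousOn_const (c := p)))⟩ : C(K, ℂ))
  have hgq : ∀ x ∈ closedBall (0 : ℂ) 1, g (q x) = x - p := by
    intro x hx
    have := congrArg (fun F : C(K, ℂ) => F ⟨q x, x, hx, rfl⟩) hg
    refine this.trans ?_
    change Function.invFunOn q (closedBall 0 1) (q x) - p = x - p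
    rw [hi.leftInvOn_invFunOn hx]
  obtain ⟨G, hGc, hG0, hGg⟩ := exists_nonvanishing_extension hK.isClosed g.continuous
    (ρ := ε / 2) (by positivity) hbK (by
      rintro _ ⟨x, hx, rfl⟩ hd
      rw [hgq x hx, sub_ne_zero]
      rintro rfl
      linarith)
  have hmaps : MapsTo q (closedBall 0 1) K := mapsTo_image _ _
  have hqc := continuousOn_iff_continuous_domRestrict.1 hq
  -- Replacing `g` by `G` in the small disk removes that zero. The result pulls back to a
  -- nonvanishing function on the unit disk equal to `s - p` on its boundary: degree `0` against
  -- degree `1`.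
  obtain ⟨u, hu, hue⟩ := exists_log_of_convex (convex_closedBall (0 : ℂ) 1)
    (q := fun x => if dist (q x) b ≤ ε / 2 then G (q x) else g (q x))
    (by
      rw [continuousOn_iff_continuous_domRestrict]
      refine Continuous.if_le (f' := fun x : closedBall (0 : ℂ) 1 => G (q x))
        (g' := fun x : closedBall (0 : ℂ) 1 => g (q x))
        (f := fun x : closedBall (0 : ℂ) 1 => dist (q x) b) (g := fun _ => ε / 2)
        (continuousOn_iff_continuous_domRestrict.1 (hGc.comp hq hmaps))
        (g.continuous.comp hqc) (hqc.dist continuous_const) continuous_const ?_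
      exact fun x hx => hGg _ (hmaps x.2) hx)
    (by
      intro x hx
      split_ifs with h
      · exact hG0 _ (hmaps hx)
      · rw [hgq x hx, sub_ne_zero]
        rintro rfl
        exact h (by linarith))
  have h0 : HasDegree (fun s => (s : ℂ) - p) 0 := by
    refine hasDegree_zero (hu.comp_continuous continuous_coe_circle coe_circle_mem) fun s => ?_
    rw [Function.comp_apply, ← hue _ (coe_circle_mem s), if_neg (not_le.2 (hSb s (by simp [Circle.norm_coe]))),
      hgq _ (coe_circle_mem s)]
  exact absurd (h0.unique (hasDegree_coe_sub (by simpa using hp))) (by norm_num)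

/-- A closed topological disk in the plane has a well-defined orientation. -/
theorem exists_orientation {q : ℂ → ℂ} (hq : ContinuousOn q (closedBall 0 1))
    (hi : InjOn q (closedBall 0 1)) :
    ∃ ε : ℤ, (ε = 1 ∨ ε = -1) ∧
      ∀ p ∈ ball (0 : ℂ) 1, HasDegree (fun s => q s - q p) ε := by
  have h0c : (0 : ℂ) ∈ closedBall (0 : ℂ) 1 := by simp
  have hne : ∀ p ∈ ball (0 : ℂ) 1, ∀ s : Circle, q s - q p ≠ 0 := by
    intro p hp s h
    have := hi (coe_circle_mem s) (ball_subset_closedBall hp) (sub_eq_zero.1 h)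
    rw [← this] at hp
    simp [Circle.norm_coe] at hp
  have hqs : Continuous fun s : Circle => q s :=
    hq.comp_continuous continuous_coe_circle coe_circle_mem
  obtain ⟨n, hn⟩ := exists_hasDegree (g := fun s => q s - q 0)
    (hqs.sub continuous_const) (hne 0 (by simp))
  refine ⟨n, ?_, fun p hp => ?_⟩
  · obtain ⟨v, hv, hvn⟩ := id hn
    let A : Set ℂ := closedBall 0 1 \ {0}
    have hA0 : ∀ x : A, (x : ℂ) ≠ 0 := fun x => x.2.2
    have hA1 : ∀ x : A, ‖(x : ℂ)‖ ≤ 1 := fun x => by simpa using x.2.1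
    -- The radial homotopy in the punctured disk from `x / ‖x‖` at time `0` to `x` at time `1`. It
    -- spreads the logarithm `v` of `(q x - q 0) / x ^ n` from the circle to the whole punctured
    -- disk.
    have hw : ∀ y : unitInterval × A,
        ∃ z ∈ A, z = ((1 - (y.1 : ℝ)) / ‖(y.2 : ℂ)‖ + (y.1 : ℝ) : ℝ) * (y.2 : ℂ) := by
      rintro ⟨t, x⟩
      have hx : 0 < ‖(x : ℂ)‖ := norm_pos_iff.2 (hA0 x)
      have hpos : 0 < (1 - (t : ℝ)) / ‖(x : ℂ)‖ + t := by
        rcases t.2.2.eq_or_lt with h | h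
        · simp [h]
        · have := div_pos (sub_pos.2 h) hx
          linarith [t.2.1]
      refine ⟨_, ⟨?_, ?_⟩, rfl⟩
      · rw [mem_closedBall_zero_iff, norm_mul, Complex.norm_real, Real.norm_of_nonneg hpos.le,
          add_mul, div_mul_cancel₀ _ hx.ne']
        nlinarith [t.2.1, hA1 x]
      · exact mul_ne_zero (by exact_mod_cast hpos.ne') (hA0 x)
    choose W hWA hW using hw
    have hWc : Continuous W := by
      have : W = _ := funext hW
      rw [this]
      refine Continuous.mul ?_ (by fun_prop)
      refine Complex.continuous_ofReal.comp (Continuous.add (Continuous.div (by fun_prop)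
        (by fun_prop) fun y => norm_ne_zero_iff.2 (hA0 y.2)) (by fun_prop))
    have hrad : ∀ x : A, ∃ s : Circle, (s : ℂ) = W (0, x) := fun x => exists_circle_eq (by
      have := norm_ne_zero_iff.2 (hA0 x)
      simp [hW, this])
    choose ρ hρ using hrad
    have hρc : Continuous ρ := by
      apply continuous_circle
      have : (fun x => (ρ x : ℂ)) = fun x => W (0, x) := funext hρ
      rw [this]
      fun_prop
    have hW1 : ∀ x : A, W (1, x) = x := fun x => by simp [hW]
    obtain ⟨w, hwc, hw⟩ := exists_log_of_homotopy (A := A)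
      (H := fun y => (q (W y) - q 0) / W y ^ n)
      (Continuous.div ((hq.comp_continuous hWc fun y => (hWA y).1).sub continuous_const)
        (hWc.zpow₀ n fun y => .inl (hWA y).2) fun y => zpow_ne_zero _ (hWA y).2)
      (fun y => div_ne_zero (sub_ne_zero.2 fun h => (hWA y).2 (hi (hWA y).1 h0c h))
        (zpow_ne_zero _ (hWA y).2))
      (u₀ := fun x => v (ρ x)) (hv.comp hρc)
      (fun x => by
        have := hvn (ρ x)
        beta_reduce at this
        rw [← hρ, this]
        field_simp [zpow_ne_zero n (ρ x).coe_ne_zero])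
    have hint := mem_interior_image hq hi (p := 0) (by simp)
    obtain ⟨r, hr, hrK⟩ := Metric.isOpen_iff.1 isOpen_interior _ hint
    have hcirc : ∀ s : Circle, q 0 + (r / 2 : ℝ) * (s : ℂ) ∈ q '' closedBall 0 1 := fun s =>
      interior_subset (hrK (by
        rw [mem_ball, dist_eq_norm, add_sub_cancel_left, norm_mul, Complex.norm_real,
          Circle.norm_coe, Real.norm_of_nonneg (by positivity)]
        linarith))
    have hr2 : ((r / 2 : ℝ) : ℂ) ≠ 0 := by
      have : r / 2 ≠ 0 := by positivity
      exact_mod_cast this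
    -- The preimage of a small circle about `q 0`. If `c` has degree `m`, then `q (c s) - q 0 = (r /
    -- 2) s` has degree `m * n` and also degree `1`, so `n` is a unit.
    let c : Circle → ℂ := fun s =>
      Function.invFunOn q (closedBall 0 1) (q 0 + (r / 2 : ℝ) * (s : ℂ))
    have hcc : Continuous c := (continuousOn_invFunOn (isCompact_closedBall 0 1) hq hi).comp_continuous
      (by fun_prop) hcirc
    have hqc : ∀ s, q (c s) = q 0 + (r / 2 : ℝ) * (s : ℂ) := fun s =>
      Function.invFunOn_eq (hcirc s)
    have hcA : ∀ s, c s ∈ A := fun s => ⟨Function.invFunOn_mem (hcirc s), fun h => by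
      have h1 := hqc s
      rw [mem_singleton_iff.1 h] at h1
      exact mul_ne_zero hr2 s.coe_ne_zero (by linear_combination -h1)⟩
    obtain ⟨m, z, hz, hzm⟩ := exists_hasDegree hcc fun s => (hcA s).2
    have h1 : HasDegree (fun s => (r / 2 : ℝ) * (s : ℂ)) (m * n) := by
      refine ⟨fun s => n * z s + w ⟨c s, hcA s⟩, by fun_prop, fun s => ?_⟩
      have h2 := hw ⟨c s, hcA s⟩
      rw [hW1, div_eq_iff (zpow_ne_zero _ (hcA s).2), hqc] at h2
      beta_reduce
      rw [Complex.exp_add, Complex.exp_int_mul, zpow_mul]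
      rw [add_sub_cancel_left] at h2
      have h3 : c s ^ n = (s ^ m : ℂ) ^ n * Complex.exp (z s) ^ n := by rw [hzm s, mul_zpow]
      rw [h2, h3]; ring
    exact Int.isUnit_iff.1 (IsUnit.of_mul_eq_one m
      ((mul_comm n m).trans (h1.unique (hasDegree_coe.const_mul hr2))))
  -- Moving the base point along the segment from `0` to `p` does not change the degree.
  · have hmem : ∀ t : unitInterval, ((t : ℝ) : ℂ) * p ∈ ball (0 : ℂ) 1 := by
      intro t
      have : ‖p‖ < 1 := by simpa using hp
      simp only [mem_ball_zero_iff, norm_mul, Complex.norm_real, Real.norm_of_nonneg t.2.1]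
      nlinarith [t.2.2, t.2.1, norm_nonneg p]
    have := HasDegree.homotopy (n := n)
      (H := fun y : unitInterval × Circle => q y.2 - q (((y.1 : ℝ) : ℂ) * p))
      ((hqs.comp continuous_snd).sub (hq.comp_continuous (by fun_prop)
        fun y => ball_subset_closedBall (hmem y.1)))
      (fun y => hne _ (hmem y.1) _) (by simpa using hn)
    simpa using this

/-! ### Charts of the sphere and Möbius quotients -/

@[simp] theorem toComplex_coe (z : ℂ) : toComplex (z : RiemannSphere) = z := rfl

theorem coe_toComplex {p : RiemannSphere} (hp : p ≠ ∞) : (toComplex p : RiemannSphere) = p := by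
  induction p using OnePoint.rec with
  | infty => exact absurd rfl hp
  | coe z => rfl

theorem continuousAt_toComplex {p : RiemannSphere} (hp : p ≠ ∞) : ContinuousAt toComplex p := by
  rw [← coe_toComplex hp, OnePoint.continuousAt_coe]
  exact continuousAt_id

theorem inversion_infty : inversion ∞ = ((0 : ℂ) : RiemannSphere) := rfl

theorem inversion_zero : inversion ((0 : ℂ) : RiemannSphere) = ∞ := if_pos rfl

theorem inversion_coe {z : ℂ} (hz : z ≠ 0) :
    inversion (z : RiemannSphere) = ((z⁻¹ : ℂ) : RiemannSphere) := if_neg hz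

theorem inversion_inversion (p : RiemannSphere) : inversion (inversion p) = p := by
  induction p using OnePoint.rec with
  | infty => exact inversion_zero
  | coe z =>
    by_cases hz : z = 0
    · rw [hz, inversion_zero, inversion_infty]
    · rw [inversion_coe hz, inversion_coe (inv_ne_zero hz), inv_inv]

theorem coclosedCompact_eq_cobounded : coclosedCompact ℂ = Bornology.cobounded ℂ := by
  rw [coclosedCompact_eq_cocompact, Metric.cobounded_eq_cocompact]

theorem continuous_inversion : Continuous inversion := by
  rw [continuous_iff_continuousAt]
  intro p
  induction p using OnePoint.rec with
  | infty =>
    rw [OnePoint.continuousAt_infty', inversion_infty, coclosedCompact_eq_cobounded]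
    refine Tendsto.congr' ?_ ((OnePoint.continuous_coe.tendsto (0 : ℂ)).comp
      (tendsto_inv₀_cobounded (α := ℂ)))
    filter_upwards [Bornology.eventually_ne_cobounded (0 : ℂ)] with z hz
    exact (inversion_coe hz).symm
  | coe z =>
    rw [OnePoint.continuousAt_coe]
    by_cases hz : z = 0
    · subst hz
      rw [continuousAt_iff_punctured_nhds, Function.comp_apply, inversion_zero]
      have h1 := (OnePoint.tendsto_coe_infty (X := ℂ))
      rw [coclosedCompact_eq_cobounded] at h1
      refine Tendsto.congr' ?_ (h1.comp (tendsto_inv₀_nhdsNE_zero (α := ℂ)))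
      filter_upwards [self_mem_nhdsWithin] with w hw
      exact (inversion_coe hw).symm
    · refine ContinuousAt.congr (OnePoint.continuous_coe.continuousAt.comp
        (continuousAt_inv₀ hz)) ?_
      filter_upwards [isOpen_ne.mem_nhds hz] with w hw
      exact (inversion_coe hw).symm

/-- The inversion of the sphere as a homeomorphism. -/
noncomputable def inversionHomeomorph : RiemannSphere ≃ₜ RiemannSphere where
  toFun := inversion
  invFun := inversion
  left_inv := inversion_inversion
  right_inv := inversion_inversion
  continuous_toFun := continuous_inversion
  continuous_invFun := continuous_inversion

/-- A Moebius transformation that carries `∞` to `b`. -/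
noncomputable def moveInfty (b : RiemannSphere) : RiemannSphere ≃ₜ RiemannSphere :=
  b.elim (Homeomorph.refl _)
    fun w => inversionHomeomorph.trans (Homeomorph.addRight w).onePointCongr

/-- A parametrization of `{b}ᶜ` by the plane. -/
noncomputable def planeParam (b : RiemannSphere) (z : ℂ) : RiemannSphere := moveInfty b z

/-- The inverse of `planeParam b`. -/
noncomputable def planeChart (b p : RiemannSphere) : ℂ := toComplex ((moveInfty b).symm p)

theorem moveInfty_infty (b : RiemannSphere) : moveInfty b ∞ = b := by
  induction b using OnePoint.rec with
  | infty => rfl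
  | coe w =>
    change ((0 + w : ℂ) : RiemannSphere) = w
    rw [zero_add]

theorem planeParam_infty (z : ℂ) : planeParam ∞ z = z := rfl

theorem planeParam_coe_zero (w : ℂ) : planeParam w 0 = ∞ := by
  change OnePoint.map (· + w) (inversion ((0 : ℂ) : RiemannSphere)) = ∞
  rw [inversion_zero]; rfl

theorem planeParam_coe (w : ℂ) {z : ℂ} (hz : z ≠ 0) :
    planeParam w z = ((z⁻¹ + w : ℂ) : RiemannSphere) := by
  change OnePoint.map (· + w) (inversion (z : RiemannSphere)) = _
  rw [inversion_coe hz]; rfl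

theorem planeParam_ne (b : RiemannSphere) (z : ℂ) : planeParam b z ≠ b := fun h =>
  OnePoint.coe_ne_infty z ((moveInfty b).injective (h.trans (moveInfty_infty b).symm))

theorem planeChart_planeParam (b : RiemannSphere) (z : ℂ) : planeChart b (planeParam b z) = z := by
  rw [planeChart, planeParam, Homeomorph.symm_apply_apply, toComplex_coe]

theorem moveInfty_symm_ne {b p : RiemannSphere} (hp : p ≠ b) : (moveInfty b).symm p ≠ ∞ := by
  intro h
  apply hp
  rw [← moveInfty_infty b, ← h, Homeomorph.apply_symm_apply]

theorem planeParam_planeChart {b p : RiemannSphere} (hp : p ≠ b) :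
    planeParam b (planeChart b p) = p := by
  rw [planeChart, planeParam, coe_toComplex (moveInfty_symm_ne hp), Homeomorph.apply_symm_apply]

theorem isOpenEmbedding_planeParam (b : RiemannSphere) :
    Topology.IsOpenEmbedding (planeParam b) :=
  (moveInfty b).isOpenEmbedding.comp OnePoint.isOpenEmbedding_coe

theorem continuousAt_planeChart {b p : RiemannSphere} (hp : p ≠ b) :
    ContinuousAt (planeChart b) p :=
  ContinuousAt.comp (continuousAt_toComplex (moveInfty_symm_ne hp))
    (moveInfty b).symm.continuous.continuousAt

theorem planeChart_injOn (b : RiemannSphere) : InjOn (planeChart b) {b}ᶜ := fun p hp p' hp' h => by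
  rw [← planeParam_planeChart hp, h, planeParam_planeChart hp']

theorem planeChart_infty (p : RiemannSphere) : planeChart ∞ p = toComplex p := rfl

theorem planeChart_coe_infty (w : ℂ) : planeChart w ∞ = 0 := by
  rw [← planeParam_coe_zero w, planeChart_planeParam]

theorem planeChart_coe_coe {w z : ℂ} (h : z ≠ w) : planeChart w z = (z - w)⁻¹ := by
  have : planeParam w (z - w)⁻¹ = z := by
    rw [planeParam_coe w (inv_ne_zero (sub_ne_zero.2 h)), inv_inv, sub_add_cancel]
  rw [← this, planeChart_planeParam]

theorem diffOrOne_coe (z w : ℂ) : diffOrOne z w = z - w := by simp [diffOrOne]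

theorem diffOrOne_infty_left (p : RiemannSphere) : diffOrOne ∞ p = 1 := by simp [diffOrOne]

theorem diffOrOne_infty_right (p : RiemannSphere) : diffOrOne p ∞ = 1 := by simp [diffOrOne]

theorem diffOrOne_ne_zero {p a : RiemannSphere} (h : p ≠ a) : diffOrOne p a ≠ 0 := by
  induction p using OnePoint.rec with
  | infty => simp [diffOrOne_infty_left]
  | coe z =>
    induction a using OnePoint.rec with
    | infty => simp [diffOrOne_infty_right]
    | coe w =>
      rw [diffOrOne_coe, sub_ne_zero]
      exact fun e => h (congrArg _ e)

theorem moebiusQuotient_mul (a b c : RiemannSphere) {p : RiemannSphere} (h : p ≠ b) :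
    moebiusQuotient a b p * moebiusQuotient b c p = moebiusQuotient a c p := by
  have := diffOrOne_ne_zero h
  simp only [moebiusQuotient]
  field_simp

/-- Both sides are Möbius transformations with zero `a` and pole `b`, hence proportional. The points
`a` and `b` are excluded because of dummy values such as `diffOrOne ∞ ∞ = 1`. -/
theorem exists_moebiusQuotient_eq {a b : RiemannSphere} (hab : a ≠ b) :
    ∃ c : ℂ, c ≠ 0 ∧ ∀ p, p ≠ a → p ≠ b →
      moebiusQuotient a b p = c * (planeChart b p - planeChart b a) := by
  induction b using OnePoint.rec with
  | infty =>
    refine ⟨1, one_ne_zero, fun p _ hpb => ?_⟩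
    rw [moebiusQuotient, diffOrOne_infty_right, planeChart_infty, planeChart_infty,
      ← coe_toComplex hab, ← coe_toComplex hpb, diffOrOne_coe]
    simp
  | coe w =>
    induction a using OnePoint.rec with
    | infty =>
      refine ⟨1, one_ne_zero, fun p hpa hpb => ?_⟩
      rw [← coe_toComplex hpa] at hpb ⊢
      rw [moebiusQuotient, diffOrOne_infty_right, planeChart_coe_infty, diffOrOne_coe,
        planeChart_coe_coe (fun h => hpb (congrArg _ h))]
      simp
    | coe v =>
      have hvw : v ≠ w := fun h => hab (congrArg _ h)
      have h1 : w - v ≠ 0 := sub_ne_zero.2 hvw.symm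
      have h2 : v - w ≠ 0 := sub_ne_zero.2 hvw
      refine ⟨w - v, h1, fun p hpa hpb => ?_⟩
      rw [planeChart_coe_coe hvw]
      induction p using OnePoint.rec with
      | infty =>
        rw [moebiusQuotient, diffOrOne_infty_left, diffOrOne_infty_left, planeChart_coe_infty]
        field_simp; ring
      | coe z =>
        have h3 : z ≠ w := fun h => hpb (congrArg _ h)
        have h4 : z - w ≠ 0 := sub_ne_zero.2 h3
        rw [moebiusQuotient, diffOrOne_coe, diffOrOne_coe, planeChart_coe_coe h3]
        field_simp; ring

/-! ### Closed Jordan regions: interior, boundary and orientation -/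

/-- `h` restricts to a homeomorphism of the closed unit disk onto `X`. -/
structure IsDiskParam (h : ℂ → RiemannSphere) (X : Set RiemannSphere) : Prop where
  continuousOn : ContinuousOn h (closedBall 0 1)
  injOn : InjOn h (closedBall 0 1)
  image_eq : h '' closedBall 0 1 = X

theorem IsClosedJordanRegion.exists_isDiskParam {X : Set RiemannSphere}
    (hX : IsClosedJordanRegion X) : ∃ h, IsDiskParam h X := by
  classical
  obtain ⟨e⟩ := hX
  let h : ℂ → RiemannSphere := fun z =>
    if hz : z ∈ closedBall (0 : ℂ) 1 then (e.symm ⟨z, hz⟩ : RiemannSphere) else ∞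
  have hh : ∀ z (hz : z ∈ closedBall (0 : ℂ) 1), h z = e.symm ⟨z, hz⟩ := fun z hz => dif_pos hz
  refine ⟨h, ?_, ?_, ?_⟩
  · rw [continuousOn_iff_continuous_domRestrict]
    have : (closedBall (0 : ℂ) 1).domRestrict h = fun z => (e.symm z : RiemannSphere) := by
      ext z; exact hh z z.2
    rw [this]; fun_prop
  · intro z hz w hw hzw
    rw [hh z hz, hh w hw] at hzw
    exact congrArg Subtype.val (e.symm.injective (Subtype.ext hzw))
  · ext p
    constructor
    · rintro ⟨z, hz, rfl⟩
      rw [hh z hz]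
      exact (e.symm _).2
    · intro hp
      refine ⟨e ⟨p, hp⟩, (e _).2, ?_⟩
      rw [hh _ (e _).2]
      simp

namespace IsDiskParam

variable {h : ℂ → RiemannSphere} {X : Set RiemannSphere}

theorem isCompact (H : IsDiskParam h X) : IsCompact X :=
  H.image_eq ▸ (isCompact_closedBall 0 1).image_of_continuousOn H.continuousOn

theorem mem (H : IsDiskParam h X) {z : ℂ} (hz : z ∈ closedBall (0 : ℂ) 1) : h z ∈ X :=
  H.image_eq ▸ mem_image_of_mem h hz

/-- If the disk covered the sphere, the disk without `1` and `-1` would be homeomorphic to a sphere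
without two points. The former is convex, while the latter contains a circle around a puncture,
contrary to `no_circle_section`. -/
theorem exists_notMem (H : IsDiskParam h X) : ∃ b, b ∉ X := by
  by_contra! hX
  have hinj : h 1 ≠ h (-1) := fun e => by
    have := H.injOn (by simp) (by simp) e
    norm_num [Complex.ext_iff] at this
  have h1 := convex_closedBall_sdiff_circle 1
  have h2 := convex_closedBall_sdiff_circle (Circle.exp Real.pi)
  have hm : ((Circle.exp Real.pi : Circle) : ℂ) = -1 := by simp
  rw [hm] at h2
  rw [Circle.coe_one] at h1
  have hA := h1.inter h2
  set A := (closedBall (0 : ℂ) 1 \ {1}) ∩ (closedBall (0 : ℂ) 1 \ {-1}) with hAdef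
  have hAne : ∀ x ∈ A, h x ≠ h (-1) := fun x hx e =>
    hx.2.2 (H.injOn hx.1.1 (by simp) e)
  have hAne' : ∀ x ∈ A, h x ≠ h 1 := fun x hx e =>
    hx.1.2 (H.injOn hx.1.1 (by simp) e)
  have hcirc : ∀ p : RiemannSphere, p ∈ h '' closedBall 0 1 := fun p => H.image_eq ▸ hX p
  let c : Circle → ℂ := fun s => Function.invFunOn h (closedBall 0 1)
    (planeParam (h (-1)) (planeChart (h (-1)) (h 1) + 1 * s))
  have hhc : ∀ s, h (c s) = planeParam (h (-1)) (planeChart (h (-1)) (h 1) + 1 * s) := fun s =>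
    Function.invFunOn_eq (hcirc _)
  have hcm : ∀ s, c s ∈ closedBall (0 : ℂ) 1 := fun s => Function.invFunOn_mem (hcirc _)
  refine no_circle_section hA (q := fun x => planeChart (h (-1)) (h x))
    (a := planeChart (h (-1)) (h 1)) (c := c) (r := 1) ?_ ?_ ?_ ?_ one_ne_zero ?_
  · intro x hx
    exact (continuousAt_planeChart (hAne x hx)).comp_continuousWithinAt
      ((H.continuousOn x hx.1.1).mono fun y hy => hy.1.1)
  · exact fun x hx e => hAne' x hx (planeChart_injOn _ (hAne x hx) hinj e)
  · exact (continuousOn_invFunOn (isCompact_closedBall 0 1) H.continuousOn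
      H.injOn).comp_continuous ((isOpenEmbedding_planeParam _).continuous.comp
        (continuous_const.add (continuous_const.mul continuous_coe_circle))) (fun s => hcirc _)
  · intro s
    refine ⟨⟨hcm s, fun e => ?_⟩, hcm s, fun e => ?_⟩
    · have := hhc s
      rw [mem_singleton_iff.1 e] at this
      have := congrArg (planeChart (h (-1))) this
      rw [planeChart_planeParam] at this
      exact s.coe_ne_zero (by linear_combination -this)
    · have := hhc s
      rw [mem_singleton_iff.1 e] at this
      exact planeParam_ne _ _ this.symm
  · intro s
    rw [hhc, planeChart_planeParam]

theorem continuousOn_planeChart (H : IsDiskParam h X) {b : RiemannSphere} (hb : b ∉ X) :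
    ContinuousOn (fun z => planeChart b (h z)) (closedBall 0 1) := fun z hz =>
  (continuousAt_planeChart (ne_of_mem_of_not_mem (H.mem hz) hb)).comp_continuousWithinAt (H.continuousOn z hz)

theorem injOn_planeChart (H : IsDiskParam h X) {b : RiemannSphere} (hb : b ∉ X) :
    InjOn (fun z => planeChart b (h z)) (closedBall 0 1) := fun _ hz _ hw e =>
  H.injOn hz hw (planeChart_injOn b (fun e' => hb (e' ▸ H.mem hz)) (fun e' => hb (e' ▸ H.mem hw)) e)

theorem preimage_planeParam (H : IsDiskParam h X) {b : RiemannSphere} (hb : b ∉ X) :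
    planeParam b ⁻¹' X = (fun z => planeChart b (h z)) '' closedBall 0 1 := by
  ext w
  constructor
  · intro hw
    rw [mem_preimage, ← H.image_eq] at hw
    obtain ⟨z, hz, hzw⟩ := hw
    exact ⟨z, hz, (congrArg _ hzw).trans (planeChart_planeParam b w)⟩
  · rintro ⟨z, hz, rfl⟩
    rw [mem_preimage, planeParam_planeChart (ne_of_mem_of_not_mem (H.mem hz) hb)]
    exact H.mem hz

/-- For points of the open disk this is invariance of domain. If a boundary point had an interior
image, a small circle about that image would lift to the disk without the boundary point, which is
convex; `no_circle_section` excludes this. -/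
theorem mem_interior_iff (H : IsDiskParam h X) {z : ℂ} (hz : z ∈ closedBall (0 : ℂ) 1) :
    h z ∈ interior X ↔ z ∈ ball (0 : ℂ) 1 := by
  obtain ⟨b, hb⟩ := H.exists_notMem
  have hne : ∀ {x}, x ∈ closedBall (0 : ℂ) 1 → h x ≠ b := fun hx =>
    ne_of_mem_of_not_mem (H.mem hx) hb
  have h1 : h z ∈ interior X ↔
      planeChart b (h z) ∈ interior ((fun z => planeChart b (h z)) '' closedBall 0 1) := by
    rw [← H.preimage_planeParam hb, ← (isOpenEmbedding_planeParam b).isOpenMap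
      |>.preimage_interior_eq_interior_preimage (isOpenEmbedding_planeParam b).continuous,
      mem_preimage, planeParam_planeChart (hne hz)]
  rw [h1]
  refine ⟨fun hint => ?_, fun hzb =>
    mem_interior_image (H.continuousOn_planeChart hb) (H.injOn_planeChart hb) hzb⟩
  by_contra hzb
  obtain ⟨s, rfl⟩ := exists_circle_eq (z := z) (by
    rw [mem_closedBall_zero_iff] at hz
    rw [mem_ball_zero_iff, not_lt] at hzb
    exact le_antisymm hz hzb)
  set q : ℂ → ℂ := fun z => planeChart b (h z) with hq
  have hqi := H.injOn_planeChart hb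
  obtain ⟨r, hr, hrK⟩ := Metric.isOpen_iff.1 isOpen_interior _ hint
  have hr2 : ((r / 2 : ℝ) : ℂ) ≠ 0 := by
    have : r / 2 ≠ 0 := by positivity
    exact_mod_cast this
  have hcirc : ∀ t : Circle, q s + (r / 2 : ℝ) * (t : ℂ) ∈ q '' closedBall 0 1 := fun t =>
    interior_subset (hrK (by
      rw [mem_ball, dist_eq_norm, add_sub_cancel_left, norm_mul, Complex.norm_real,
        Circle.norm_coe, Real.norm_of_nonneg (by positivity)]
      linarith))
  refine no_circle_section (convex_closedBall_sdiff_circle s) (q := q) (a := q s)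
    (c := fun t => Function.invFunOn q (closedBall 0 1) (q s + (r / 2 : ℝ) * (t : ℂ)))
    ((H.continuousOn_planeChart hb).mono sdiff_subset)
    (fun x hx e => hx.2 (hqi hx.1 (coe_circle_mem s) e))
    ((continuousOn_invFunOn (isCompact_closedBall 0 1) (H.continuousOn_planeChart hb)
      hqi).comp_continuous (by fun_prop) hcirc)
    (fun t => ⟨Function.invFunOn_mem (hcirc t), fun e => ?_⟩) hr2
    (fun t => Function.invFunOn_eq (hcirc t))
  have h2 := Function.invFunOn_eq (hcirc t)
  rw [mem_singleton_iff.1 e] at h2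
  exact mul_ne_zero hr2 t.coe_ne_zero (by linear_combination -h2)

theorem interior_eq (H : IsDiskParam h X) : interior X = h '' ball 0 1 := by
  ext p
  constructor
  · intro hp
    obtain ⟨z, hz, rfl⟩ : p ∈ h '' closedBall 0 1 := H.image_eq ▸ interior_subset hp
    exact ⟨z, (H.mem_interior_iff hz).1 hp, rfl⟩
  · rintro ⟨z, hz, rfl⟩
    exact (H.mem_interior_iff (ball_subset_closedBall hz)).2 hz

theorem frontier_eq (H : IsDiskParam h X) : frontier X = h '' sphere 0 1 := by
  rw [H.isCompact.isClosed.frontier_eq, H.interior_eq, ← H.image_eq,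
    ← InjOn.image_sdiff_subset H.injOn ball_subset_closedBall, closedBall_sdiff_ball]

theorem isJordanParametrization (H : IsDiskParam h X) :
    IsJordanParametrization (fun s => h s) (frontier X) := by
  refine ⟨H.continuousOn.comp_continuous continuous_coe_circle coe_circle_mem,
    fun s t e => Subtype.ext (H.injOn (coe_circle_mem s) (coe_circle_mem t) e), ?_⟩
  rw [H.frontier_eq]
  ext p
  constructor
  · rintro ⟨s, rfl⟩
    exact ⟨s, by simp [Circle.norm_coe], rfl⟩
  · rintro ⟨z, hz, rfl⟩
    obtain ⟨s, rfl⟩ := exists_circle_eq (mem_sphere_zero_iff_norm.1 hz)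
    exact ⟨s, rfl⟩

theorem circle_notMem_interior (H : IsDiskParam h X) (s : Circle) : h s ∉ interior X := by
  rw [H.mem_interior_iff (coe_circle_mem s)]
  simp [Circle.norm_coe]

theorem exists_hasDegree_planeChart (H : IsDiskParam h X) {b : RiemannSphere} (hb : b ∉ X) :
    ∃ ε : ℤ, (ε = 1 ∨ ε = -1) ∧ ∀ a ∈ interior X,
      HasDegree (fun s => planeChart b (h s) - planeChart b a) ε := by
  obtain ⟨ε, hε, hd⟩ := exists_orientation (H.continuousOn_planeChart hb) (H.injOn_planeChart hb)
  refine ⟨ε, hε, ?_⟩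
  rw [H.interior_eq]
  rintro _ ⟨p, hp, rfl⟩
  exact hd p hp

theorem hasDegree_moebiusQuotient_iff (H : IsDiskParam h X) {a b : RiemannSphere}
    (ha : a ∈ interior X) (hb : b ∉ X) {n : ℤ} :
    HasDegree (fun s => moebiusQuotient a b (h s)) n ↔
      HasDegree (fun s => planeChart b (h s) - planeChart b a) n := by
  obtain ⟨c, hc, hce⟩ := exists_moebiusQuotient_eq (a := a) (b := b)
    (fun e => hb (e ▸ interior_subset ha))
  have hs : ∀ s : Circle, moebiusQuotient a b (h s) =
      c * (planeChart b (h s) - planeChart b a) := fun s =>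
    hce _ (fun e => H.circle_notMem_interior s (e ▸ ha)) (fun e => hb (e ▸ H.mem (coe_circle_mem s)))
  refine ⟨fun hd => ?_, fun hd => (hd.const_mul hc).congr hs⟩
  exact (hd.const_mul (inv_ne_zero hc)).congr fun s => by rw [hs, inv_mul_cancel_left₀ hc]

/-- With zero and pole both outside `X`, the quotient extends without zeros over the whole disk. -/
theorem hasDegree_moebiusQuotient_of_notMem (H : IsDiskParam h X) {b b' : RiemannSphere}
    (hb : b ∉ X) (hb' : b' ∉ X) : HasDegree (fun s => moebiusQuotient b b' (h s)) 0 := by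
  have hne : ∀ z ∈ closedBall (0 : ℂ) 1, h z ≠ b := fun z hz e => hb (e ▸ H.mem hz)
  have hne' : ∀ z ∈ closedBall (0 : ℂ) 1, h z ≠ b' := fun z hz e => hb' (e ▸ H.mem hz)
  by_cases hbb : b = b'
  · subst hbb
    refine (hasDegree_const one_ne_zero).congr fun s => ?_
    exact div_self (diffOrOne_ne_zero (hne s (coe_circle_mem s)))
  · obtain ⟨c, hc, hce⟩ := exists_moebiusQuotient_eq hbb
    obtain ⟨u, hu, hue⟩ := exists_log_of_convex (convex_closedBall (0 : ℂ) 1)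
      (q := fun z => c * (planeChart b' (h z) - planeChart b' b))
      (continuousOn_const.mul ((H.continuousOn_planeChart hb').sub continuousOn_const))
      (fun z hz => mul_ne_zero hc (sub_ne_zero.2 fun e =>
        hne z hz (planeChart_injOn b' (hne' z hz) hbb e)))
    refine hasDegree_zero (hu.comp_continuous continuous_coe_circle coe_circle_mem) fun s => ?_
    rw [hce _ (hne s (coe_circle_mem s)) (hne' s (coe_circle_mem s)), Function.comp_apply,
      ← hue _ (coe_circle_mem s)]

/-- Passing from `b` to `b'` multiplies by a quotient with zero and pole outside `X`, of degree `0`;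
so one sign serves all pairs. -/
theorem exists_hasDegree_moebiusQuotient (H : IsDiskParam h X) :
    ∃ ε : ℤ, (ε = 1 ∨ ε = -1) ∧ ∀ a ∈ interior X, ∀ b ∉ X,
      HasDegree (fun s => moebiusQuotient a b (h s)) ε := by
  obtain ⟨b, hb⟩ := H.exists_notMem
  obtain ⟨ε, hε, hd⟩ := H.exists_hasDegree_planeChart hb
  refine ⟨ε, hε, fun a ha b' hb' => ?_⟩
  have h1 := ((H.hasDegree_moebiusQuotient_iff ha hb).2 (hd a ha)).mul
    (H.hasDegree_moebiusQuotient_of_notMem hb hb')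
  rw [add_zero] at h1
  exact h1.congr fun s => (moebiusQuotient_mul a b b' fun e =>
    hb (e ▸ H.mem (coe_circle_mem s))).symm

end IsDiskParam

/-- A closed Jordan region has a parametrization by the disk that induces the orientation of the
boundary for which the region lies on the left. -/
theorem IsClosedJordanRegion.exists_oriented {X : Set RiemannSphere}
    (hX : IsClosedJordanRegion X) :
    ∃ h, IsDiskParam h X ∧ LiesOnLeft X (fun s : Circle => h s) := by
  obtain ⟨h, H⟩ := hX.exists_isDiskParam
  obtain ⟨ε, rfl | rfl, hd⟩ := H.exists_hasDegree_moebiusQuotient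
  · exact ⟨h, H, H.isJordanParametrization, fun a ha b hb => (hd a ha b hb).hasWindingNumber⟩
  -- Conjugation is `s ↦ s⁻¹` on the circle, of degree `-1`, so it reverses a wrong orientation.
  · have hmaps : MapsTo (starRingEnd ℂ) (closedBall (0 : ℂ) 1) (closedBall 0 1) :=
      fun z hz => by simpa using hz
    have H' : IsDiskParam (fun z => h (starRingEnd ℂ z)) X := by
      refine ⟨H.continuousOn.comp Complex.continuous_conj.continuousOn hmaps,
        fun z hz w hw e => (starRingEnd ℂ).injective (H.injOn (hmaps hz) (hmaps hw) e), ?_⟩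
      rw [← H.image_eq]
      ext p
      constructor
      · rintro ⟨z, hz, rfl⟩
        exact ⟨_, hmaps hz, rfl⟩
      · rintro ⟨z, hz, rfl⟩
        exact ⟨_, hmaps hz, by simp⟩
    refine ⟨_, H', H'.isJordanParametrization, fun a ha b hb => HasDegree.hasWindingNumber ?_⟩
    refine ((hd a ha b hb).comp (σ := fun s => s⁻¹) continuous_inv hasDegree_inv).congr fun s => ?_
    rw [Circle.coe_inv_eq_conj]

theorem LiesOnLeft.hasDegree_planeChart {X : Set RiemannSphere} {h : ℂ → RiemannSphere}
    (hl : LiesOnLeft X (fun s : Circle => h s)) (H : IsDiskParam h X) {a b : RiemannSphere}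
    (ha : a ∈ interior X) (hb : b ∉ X) :
    HasDegree (fun s => planeChart b (h s) - planeChart b a) 1 :=
  (H.hasDegree_moebiusQuotient_iff ha hb).1 (hl.2 a ha b hb).hasDegree

/-! ### Factoring out zeros -/

/-- The zeros of a holomorphic function can be factored out, if they are finitely many. -/
theorem exists_factorization {A O : Set ℂ} (hO : IsOpen O) (hOA : O ⊆ A) (Z : Finset ℂ) :
    ∀ {φ : ℂ → ℂ}, ContinuousOn φ A → DifferentiableOn ℂ φ O → (∀ z ∈ A, φ z = 0 ↔ z ∈ Z) →
      (∀ z ∈ Z, z ∈ O) → (∀ z ∈ Z, ¬ ∀ᶠ w in 𝓝 z, φ w = 0) →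
      ∃ (M : Multiset ℂ) (G : ℂ → ℂ), (∀ a ∈ M, a ∈ O) ∧ ContinuousOn G A ∧
        DifferentiableOn ℂ G O ∧ (∀ z ∈ A, G z ≠ 0) ∧
        ∀ z ∈ A, φ z = (M.map (z - ·)).prod * G z := by
  classical
  induction Z using Finset.induction with
  | empty =>
    intro φ hc hd hz _ _
    exact ⟨0, φ, by simp, hc, hd, fun z hzA h => by simpa using (hz z hzA).1 h, by simp⟩
  | insert a Z haZ ih =>
    intro φ hc hd hz hZO hnt
    have haO : a ∈ O := hZO a (by simp)
    have han : AnalyticAt ℂ φ a := hd.analyticAt (hO.mem_nhds haO)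
    obtain ⟨n, g, hg, hga, hev⟩ :=
      han.exists_eventuallyEq_pow_smul_nonzero_iff.2 (hnt a (by simp))
    have hφa : φ a = 0 := (hz a (hOA haO)).2 (by simp)
    have hn : n ≠ 0 := by
      rintro rfl
      have := hev.self_of_nhds
      rw [hφa] at this
      simp [eq_comm, hga] at this
    -- Division by the full power of `z - a`, with the value at `a` filled in by `g a ≠ 0`, leaves
    -- exactly the zeros in `Z`.
    let ψ : ℂ → ℂ := fun z => if z = a then g a else φ z / (z - a) ^ n
    have hψa : ψ a = g a := if_pos rfl
    have hψ : ∀ z, z ≠ a → ψ z = φ z / (z - a) ^ n := fun z h => if_neg h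
    have hpow : ∀ z, z ≠ a → (z - a) ^ n ≠ 0 := fun z h => pow_ne_zero _ (sub_ne_zero.2 h)
    have hψev : ψ =ᶠ[𝓝 a] g := by
      filter_upwards [hev] with z hzg
      by_cases h : z = a
      · rw [h, hψa]
      · rw [hψ z h, hzg, smul_eq_mul, mul_div_cancel_left₀ _ (hpow z h)]
    have hψne : ∀ z, z ≠ a → ψ =ᶠ[𝓝 z] fun z => φ z / (z - a) ^ n := fun z h => by
      filter_upwards [isOpen_ne.mem_nhds h] with w hw using hψ w hw
    have hψc : ContinuousOn ψ A := by
      intro z hzA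
      by_cases h : z = a
      · rw [h]
        exact (hg.continuousAt.congr hψev.symm).continuousWithinAt
      · refine ContinuousWithinAt.congr_of_eventuallyEq (f := fun z => φ z / (z - a) ^ n) ?_
          ((hψne z h).filter_mono nhdsWithin_le_nhds) (hψ z h)
        exact (hc z hzA).div (by fun_prop) (hpow z h)
    have hψd : DifferentiableOn ℂ ψ O := by
      intro z hzO
      refine DifferentiableAt.differentiableWithinAt ?_
      by_cases h : z = a
      · rw [h]
        exact hg.differentiableAt.congr_of_eventuallyEq hψev
      · refine DifferentiableAt.congr_of_eventuallyEq ?_ (hψne z h)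
        exact (hd.differentiableAt (hO.mem_nhds hzO)).div (by fun_prop) (hpow z h)
    obtain ⟨M, G, hM, hG, hGd, hG0, hfac⟩ := ih hψc hψd
      (by
        intro z hzA
        by_cases h : z = a
        · rw [h, hψa]
          simp [hga, haZ]
        · rw [hψ z h, div_eq_zero_iff, hz z hzA]
          simp only [hpow z h, or_false, Finset.mem_insert, h, false_or])
      (fun z hzZ => hZO z (by simp [hzZ]))
      (fun z hzZ hev' => by
        have h : z ≠ a := fun e => haZ (e ▸ hzZ)
        refine hnt z (by simp [hzZ]) ?_
        filter_upwards [hev', hψne z h, isOpen_ne.mem_nhds h] with w h1 h2 h3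
        rw [h1] at h2
        simpa [hpow w h3] using h2.symm)
    refine ⟨Multiset.replicate n a + M, G, ?_, hG, hGd, hG0, ?_⟩
    · intro b hb
      rcases Multiset.mem_add.1 hb with hb | hb
      · rw [Multiset.eq_of_mem_replicate hb]; exact haO
      · exact hM b hb
    · intro z hzA
      rw [Multiset.map_add, Multiset.prod_add, Multiset.map_replicate, Multiset.prod_replicate,
        mul_assoc, ← hfac z hzA]
      by_cases h : z = a
      · rw [h, hφa, sub_self, zero_pow hn, zero_mul]
      · rw [hψ z h, mul_div_cancel₀ _ (hpow z h)]

theorem multiset_prod_sub_eq_zero {M : Multiset ℂ} {z : ℂ} :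
    (M.map (z - ·)).prod = 0 ↔ z ∈ M := by
  rw [Multiset.prod_eq_zero_iff, Multiset.mem_map]
  constructor
  · rintro ⟨a, ha, h⟩
    rwa [sub_eq_zero.1 h]
  · exact fun h => ⟨z, h, sub_self z⟩

theorem continuous_multiset_prod_sub (M : Multiset ℂ) :
    Continuous fun z : ℂ => (M.map (z - ·)).prod := by
  induction M using Multiset.induction with
  | empty => simpa using continuous_const
  | cons a M ih =>
    simp only [Multiset.map_cons, Multiset.prod_cons]
    exact Continuous.fun_mul (by fun_prop) ih

theorem continuousAt_moebiusQuotient {a b p : RiemannSphere} (ha : p ≠ a) (hb : p ≠ b) :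
    ContinuousAt (moebiusQuotient a b) p := by
  by_cases hab : a = b
  · subst hab
    refine (continuousAt_const (y := (1 : ℂ))).congr ?_
    filter_upwards [isOpen_ne.mem_nhds ha] with y hy
    exact (div_self (diffOrOne_ne_zero hy)).symm
  · obtain ⟨c, -, hce⟩ := exists_moebiusQuotient_eq hab
    refine ((continuousAt_const (y := c)).mul ((continuousAt_planeChart hb).sub
      (continuousAt_const (y := planeChart b a)))).congr ?_
    filter_upwards [isOpen_ne.mem_nhds ha, isOpen_ne.mem_nhds hb] with y hy hy'
    exact (hce y hy hy').symm

/-! ### Fibers of a holomorphic map on a plane disk and the argument principle -/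

/-- A continuous injection `e` of the closed disk into the plane, with image `K`, together with a
map `F` of `K` into the sphere that is holomorphic and finite in the interior of `K` and injective
on the boundary. -/
structure IsDiskMap (e : ℂ → ℂ) (F : ℂ → RiemannSphere) : Prop where
  continuousOn_param : ContinuousOn e (closedBall 0 1)
  injOn_param : InjOn e (closedBall 0 1)
  hasDegree : ∀ p ∈ ball (0 : ℂ) 1, HasDegree (fun s => e s - e p) 1
  isOpen_image : IsOpen (e '' ball 0 1)
  continuousOn : ContinuousOn F (e '' closedBall 0 1)
  ne_infty : ∀ z ∈ e '' ball 0 1, F z ≠ ∞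
  differentiableOn : DifferentiableOn ℂ (fun z => toComplex (F z)) (e '' ball 0 1)
  injective : Function.Injective fun s : Circle => F (e s)

/-- The multiset `M` consists of the solutions of `F z = w` in `e '' ball 0 1`, which are counted
with multiplicities. -/
def IsFiber (e : ℂ → ℂ) (F : ℂ → RiemannSphere) (w : ℂ) (M : Multiset ℂ) : Prop :=
  ∃ G : ℂ → ℂ, (∀ a ∈ M, a ∈ e '' ball 0 1) ∧
    ContinuousOn G {z ∈ e '' closedBall 0 1 | F z ≠ ∞} ∧ DifferentiableOn ℂ G (e '' ball 0 1) ∧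
    (∀ z ∈ e '' closedBall 0 1, F z ≠ ∞ → G z ≠ 0) ∧
    ∀ z ∈ e '' closedBall 0 1, F z ≠ ∞ → toComplex (F z) - w = (M.map (z - ·)).prod * G z

namespace IsFiber

variable {e : ℂ → ℂ} {F : ℂ → RiemannSphere} {w : ℂ} {M : Multiset ℂ}

theorem mem_iff (hM : IsFiber e F w M) {z : ℂ} (hz : z ∈ e '' closedBall 0 1) (hF : F z ≠ ∞) :
    z ∈ M ↔ F z = w := by
  obtain ⟨G, -, -, -, hG0, hfac⟩ := hM
  rw [← multiset_prod_sub_eq_zero, ← mul_eq_zero_iff_right (hG0 z hz hF), ← hfac z hz hF,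
    sub_eq_zero]
  conv_rhs => rw [← coe_toComplex hF]
  exact (OnePoint.coe_injective.eq_iff).symm

theorem mem_image (hM : IsFiber e F w M) {a : ℂ} (ha : a ∈ M) : a ∈ e '' ball 0 1 :=
  hM.choose_spec.1 a ha

end IsFiber

namespace IsDiskMap

variable {e : ℂ → ℂ} {F : ℂ → RiemannSphere}

theorem image_ball_subset : e '' ball 0 1 ⊆ e '' closedBall 0 1 :=
  image_mono ball_subset_closedBall

theorem param_mem (s : Circle) : e s ∈ e '' closedBall 0 1 := ⟨s, coe_circle_mem s, rfl⟩

theorem mapsTo : MapsTo e (closedBall 0 1) (e '' closedBall 0 1) := mapsTo_image _ _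

theorem isCompact (H : IsDiskMap e F) : IsCompact (e '' closedBall 0 1) :=
  (isCompact_closedBall 0 1).image_of_continuousOn H.continuousOn_param

theorem mem_ball_or (z : ℂ) (hz : z ∈ e '' closedBall 0 1) :
    z ∈ e '' ball 0 1 ∨ ∃ s : Circle, z = e s := by
  obtain ⟨x, hx, rfl⟩ := hz
  rcases (mem_closedBall_zero_iff.1 hx).lt_or_eq with h | h
  · exact .inl ⟨x, mem_ball_zero_iff.2 h, rfl⟩
  · obtain ⟨s, rfl⟩ := exists_circle_eq h
    exact .inr ⟨s, rfl⟩

theorem isPreconnected (H : IsDiskMap e F) : IsPreconnected (e '' ball 0 1) :=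
  (convex_ball (0 : ℂ) 1).isPreconnected.image _
    (H.continuousOn_param.mono ball_subset_closedBall)

theorem differentiableAt (H : IsDiskMap e F) {z : ℂ} (hz : z ∈ e '' ball 0 1) :
    DifferentiableAt ℂ (fun z => toComplex (F z)) z :=
  H.differentiableOn.differentiableAt (H.isOpen_image.mem_nhds hz)

theorem analyticAt (H : IsDiskMap e F) {z : ℂ} (hz : z ∈ e '' ball 0 1) :
    AnalyticAt ℂ (fun z => toComplex (F z)) z :=
  H.differentiableOn.analyticAt (H.isOpen_image.mem_nhds hz)

/-- By the identity theorem and continuity, a locally constant `F` would be constant on the closed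
disk, against injectivity on the boundary. -/
theorem not_eventually_eq (H : IsDiskMap e F) {z : ℂ} (hz : z ∈ e '' ball 0 1) (w : ℂ) :
    ¬ ∀ᶠ y in 𝓝 z, toComplex (F y) - w = 0 := by
  intro hev
  have h1 : EqOn (fun y => toComplex (F y) - w) 0 (e '' ball 0 1) :=
    AnalyticOnNhd.eqOn_zero_of_preconnected_of_eventuallyEq_zero
      (fun y hy => (H.analyticAt hy).sub analyticAt_const) H.isPreconnected hz hev
  have h2 : EqOn (F ∘ e) (fun _ => (w : RiemannSphere)) (ball 0 1) := by
    intro x hx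
    have := h1 ⟨x, hx, rfl⟩
    rw [Function.comp_apply, ← coe_toComplex (H.ne_infty _ ⟨x, hx, rfl⟩), sub_eq_zero.1 this]
  have h3 : EqOn (F ∘ e) (fun _ => (w : RiemannSphere)) (closedBall 0 1) :=
    h2.of_subset_closure (H.continuousOn.comp H.continuousOn_param mapsTo) continuousOn_const
      ball_subset_closedBall (by rw [closure_ball _ one_ne_zero])
  have h4 : (1 : Circle) = Circle.exp Real.pi :=
    H.injective ((h3 (coe_circle_mem _)).trans (h3 (coe_circle_mem _)).symm)
  have := congrArg (fun s : Circle => (s : ℂ)) h4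
  norm_num at this

/-- `F` is an open map in the interior. -/
theorem nhds_le_map (H : IsDiskMap e F) {z : ℂ} (hz : z ∈ e '' ball 0 1) :
    𝓝 (F z) ≤ map F (𝓝 z) := by
  rcases (H.analyticAt hz).eventually_constant_or_nhds_le_map_nhds with h | h
  · refine absurd ?_ (H.not_eventually_eq hz (toComplex (F z)))
    filter_upwards [h] with y hy
    rw [hy, sub_self]
  · have h1 := map_mono (m := ((↑) : ℂ → RiemannSphere)) h
    rw [← OnePoint.nhds_coe_eq, coe_toComplex (H.ne_infty z hz), map_map] at h1
    refine h1.trans_eq (Filter.map_congr ?_)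
    filter_upwards [H.isOpen_image.mem_nhds hz] with y hy using coe_toComplex (H.ne_infty y hy)

/-- Infinitely many solutions would accumulate in the compact disk, and not on its boundary, where
`w` is not attained; the identity theorem forbids an interior accumulation point. -/
theorem finite_fiber (H : IsDiskMap e F) {w : ℂ} (hw : ∀ s : Circle, F (e s) ≠ w) :
    {z ∈ e '' closedBall 0 1 | F z = w}.Finite := by
  by_contra hinf
  have hcl : IsClosed {z ∈ e '' closedBall 0 1 | F z = w} :=
    H.continuousOn.preimage_isClosed_of_isClosed H.isCompact.isClosed isClosed_singleton
  have hc : IsCompact {z ∈ e '' closedBall 0 1 | F z = w} :=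
    H.isCompact.of_isClosed_subset hcl (sep_subset _ _)
  obtain ⟨z, hz, hacc⟩ := Set.Infinite.exists_accPt_of_subset_isCompact hinf hc subset_rfl
  have hzO : z ∈ e '' ball 0 1 := (mem_ball_or z hz.1).resolve_right (by
    rintro ⟨s, rfl⟩
    exact hw s hz.2)
  refine H.not_eventually_eq hzO w (((H.analyticAt hzO).sub
    analyticAt_const).frequently_zero_iff_eventually_zero.1 ?_)
  rw [accPt_iff_frequently] at hacc
  rw [frequently_nhdsWithin_iff]
  refine hacc.mono fun y hy => ⟨?_, hy.1⟩
  simp [hy.2.2]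

theorem exists_isFiber (H : IsDiskMap e F) {w : ℂ} (hw : ∀ s : Circle, F (e s) ≠ w) :
    ∃ M, IsFiber e F w M := by
  have hfin := H.finite_fiber hw
  have hmem : ∀ z, z ∈ hfin.toFinset → z ∈ e '' ball 0 1 := by
    intro z hz
    rw [Finite.mem_toFinset] at hz
    refine (mem_ball_or z hz.1).resolve_right ?_
    rintro ⟨s, rfl⟩
    exact hw s hz.2
  obtain ⟨M, G, h1, h2, h3, h4, h5⟩ := exists_factorization (A := {z ∈ e '' closedBall 0 1 | F z ≠ ∞})
    H.isOpen_image (fun z hz => ⟨image_ball_subset hz, H.ne_infty z hz⟩) hfin.toFinset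
    (φ := fun z => toComplex (F z) - w)
    (fun z hz => ((continuousAt_toComplex hz.2).comp_continuousWithinAt
      ((H.continuousOn z hz.1).mono (sep_subset _ _))).sub continuousWithinAt_const)
    (H.differentiableOn.sub_const w)
    (by
      intro z hz
      rw [Finite.mem_toFinset, sub_eq_zero]
      constructor
      · intro h
        exact ⟨hz.1, by rw [← coe_toComplex hz.2, h]⟩
      · intro h
        rw [h.2, toComplex_coe])
    hmem (fun z hz => H.not_eventually_eq (hmem z hz) w)
  exact ⟨M, G, h1, h2, h3, fun z hz hF => h4 z ⟨hz, hF⟩, fun z hz hF => h5 z ⟨hz, hF⟩⟩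

theorem hasDegree_multiset (H : IsDiskMap e F) {M : Multiset ℂ}
    (hM : ∀ a ∈ M, a ∈ e '' ball 0 1) :
    HasDegree (fun s => (M.map (e s - ·)).prod) M.card := by
  have := hasDegree_multiset_prod (g := fun a s => e s - a) (n := 1) M (by
    intro a ha
    obtain ⟨p, hp, rfl⟩ := hM a ha
    exact H.hasDegree p hp)
  simpa using this

theorem hasDegree_of_continuousOn {R : ℂ → ℂ} (hR : ContinuousOn R (closedBall 0 1))
    (h0 : ∀ x ∈ closedBall (0 : ℂ) 1, R x ≠ 0) : HasDegree (fun s => R s) 0 := by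
  obtain ⟨u, hu, hue⟩ := exists_log_of_convex (convex_closedBall (0 : ℂ) 1) hR h0
  exact hasDegree_zero (hu.comp_continuous continuous_coe_circle coe_circle_mem)
    fun s => hue _ (coe_circle_mem s)

/-- The argument principle. -/
theorem hasDegree_sub (H : IsDiskMap e F) {w : ℂ} {M : Multiset ℂ} (hM : IsFiber e F w M)
    (hfin : ∀ s : Circle, F (e s) ≠ ∞) :
    HasDegree (fun s => toComplex (F (e s)) - w) M.card := by
  obtain ⟨G, hMO, hG, -, hG0, hfac⟩ := hM
  have hF : ∀ z ∈ e '' closedBall 0 1, F z ≠ ∞ := by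
    intro z hz
    rcases mem_ball_or z hz with h | ⟨s, rfl⟩
    · exact H.ne_infty z h
    · exact hfin s
  have h1 : HasDegree (fun s => G (e s)) 0 :=
    hasDegree_of_continuousOn (R := fun x => G (e x))
      (hG.comp H.continuousOn_param fun x hx => ⟨mapsTo hx, hF _ (mapsTo hx)⟩)
      fun x hx => hG0 _ (mapsTo hx) (hF _ (mapsTo hx))
  simpa using ((H.hasDegree_multiset hMO).mul h1).congr
    fun s => hfac _ (param_mem s) (hfin s)

/-- The argument principle for a quotient. -/
theorem hasDegree_moebiusQuotient (H : IsDiskMap e F) {w b : ℂ} {M N : Multiset ℂ}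
    (hM : IsFiber e F w M) (hN : IsFiber e F b N) (hb : ∀ s : Circle, F (e s) ≠ b) {n : ℤ}
    (hn : HasDegree (fun s => moebiusQuotient w b (F (e s))) n) : (M.card : ℤ) = n + N.card := by
  classical
  have hMO : ∀ a ∈ M, a ∈ e '' ball 0 1 := fun a ha => hM.mem_image ha
  have hNO : ∀ a ∈ N, a ∈ e '' ball 0 1 := fun a ha => hN.mem_image ha
  obtain ⟨G, -, hG, -, hG0, hGfac⟩ := hM
  obtain ⟨K, -, hK, -, hK0, hKfac⟩ := hN
  set P : ℂ → ℂ := fun z => (M.map (z - ·)).prod with hP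
  set Q : ℂ → ℂ := fun z => (N.map (z - ·)).prod with hQ
  have hPc : Continuous P := continuous_multiset_prod_sub M
  have hQc : Continuous Q := continuous_multiset_prod_sub N
  have hP0 : ∀ z, F z = ∞ → P z ≠ 0 := fun z hz h =>
    H.ne_infty z (hMO z (multiset_prod_sub_eq_zero.1 h)) hz
  have hQ0 : ∀ z, F z = ∞ → Q z ≠ 0 := fun z hz h =>
    H.ne_infty z (hNO z (multiset_prod_sub_eq_zero.1 h)) hz
  have hmq : ∀ z ∈ e '' closedBall 0 1, F z ≠ ∞ →
      moebiusQuotient w b (F z) = P z * G z / (Q z * K z) := by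
    intro z hz hF
    conv_lhs => rw [← coe_toComplex hF]
    rw [moebiusQuotient, diffOrOne_coe, diffOrOne_coe, hGfac z hz hF, hKfac z hz hF]
  have hmq1 : moebiusQuotient w b ∞ = 1 := by
    rw [moebiusQuotient, diffOrOne_infty_left, diffOrOne_infty_left, div_one]
  -- The zero-free part of the quotient is `G / K`, but nothing is known of `G` and `K` where `F =
  -- ∞`. There it is defined by `R₂`, which agrees with `R₁` at nearby finite values and is
  -- continuous, since the Möbius quotient is continuous at `∞` with value `1`.
  let R₁ : ℂ → ℂ := fun x => G (e x) / K (e x)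
  let R₂ : ℂ → ℂ := fun x => moebiusQuotient w b (F (e x)) * Q (e x) / P (e x)
  let R : ℂ → ℂ := fun x => if F (e x) = ∞ then R₂ x else R₁ x
  have hFe : ContinuousOn (fun x => F (e x)) (closedBall 0 1) :=
    H.continuousOn.comp H.continuousOn_param mapsTo
  have hR₁0 : ∀ x ∈ closedBall (0 : ℂ) 1, F (e x) ≠ ∞ → R₁ x ≠ 0 := fun x hx hF =>
    div_ne_zero (hG0 _ (mapsTo hx) hF) (hK0 _ (mapsTo hx) hF)
  have hR0 : ∀ x ∈ closedBall (0 : ℂ) 1, R x ≠ 0 := by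
    intro x hx
    by_cases hF : F (e x) = ∞
    · simp only [R, R₂, if_pos hF]
      rw [hF, hmq1, one_mul]
      exact div_ne_zero (hQ0 _ hF) (hP0 _ hF)
    · simp only [R, if_neg hF]
      exact hR₁0 x hx hF
  have hRc : ContinuousOn R (closedBall 0 1) := by
    intro x hx
    have hex := H.continuousOn_param x hx
    by_cases hF : F (e x) = ∞
    · have hcont : ContinuousWithinAt R₂ (closedBall 0 1) x := by
        have h1 : ContinuousAt (moebiusQuotient w b) (F (e x)) := by
          rw [hF]
          exact continuousAt_moebiusQuotient (OnePoint.infty_ne_coe w) (OnePoint.infty_ne_coe b)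
        have h2 : Tendsto (fun x => moebiusQuotient w b (F (e x))) (𝓝[closedBall 0 1] x)
          (𝓝 (moebiusQuotient w b (F (e x)))) := h1.tendsto.comp (hFe x hx).tendsto
        have h3 : Tendsto (fun x => Q (e x)) (𝓝[closedBall 0 1] x) (𝓝 (Q (e x))) :=
          (hQc.tendsto _).comp hex.tendsto
        have h4 : Tendsto (fun x => P (e x)) (𝓝[closedBall 0 1] x) (𝓝 (P (e x))) :=
          (hPc.tendsto _).comp hex.tendsto
        exact (h2.mul h3).div h4 (hP0 _ hF)
      refine hcont.congr_of_eventuallyEq ?_ (if_pos hF)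
      have hP' : ∀ᶠ y in 𝓝[closedBall 0 1] x, P (e y) ≠ 0 :=
        (hPc.continuousAt.comp_continuousWithinAt hex).eventually_ne (hP0 _ hF)
      have hQ' : ∀ᶠ y in 𝓝[closedBall 0 1] x, Q (e y) ≠ 0 :=
        (hQc.continuousAt.comp_continuousWithinAt hex).eventually_ne (hQ0 _ hF)
      filter_upwards [hP', hQ', self_mem_nhdsWithin] with y hPy hQy hy
      by_cases hFy : F (e y) = ∞
      · exact if_pos hFy
      · have hKy := hK0 _ (mapsTo hy) hFy
        simp only [R, R₁, R₂, if_neg hFy]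
        rw [hmq _ (mapsTo hy) hFy]
        field_simp
    · have hcont : ContinuousWithinAt R₁ (closedBall 0 1) x := by
        have hev : ∀ᶠ y in 𝓝[closedBall 0 1] x, e y ∈ {z ∈ e '' closedBall 0 1 | F z ≠ ∞} := by
          filter_upwards [(hFe x hx).eventually_ne hF, self_mem_nhdsWithin] with y h1 h2
          exact ⟨mapsTo h2, h1⟩
        have ht := tendsto_nhdsWithin_of_tendsto_nhds_of_eventually_within _ hex hev
        exact Tendsto.div ((hG (e x) ⟨mapsTo hx, hF⟩).tendsto.comp ht)
          ((hK (e x) ⟨mapsTo hx, hF⟩).tendsto.comp ht) (hK0 _ (mapsTo hx) hF)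
      refine hcont.congr_of_eventuallyEq ?_ (if_neg hF)
      filter_upwards [(hFe x hx).eventually_ne hF] with y hy using if_neg hy
  have h1 := hn.mul (H.hasDegree_multiset hNO)
  have h2 := (H.hasDegree_multiset hMO).mul (hasDegree_of_continuousOn hRc hR0)
  rw [add_zero] at h2
  refine (h2.congr fun s => ?_).unique h1
  change moebiusQuotient w b (F (e s)) * Q (e s) = P (e s) * R s
  by_cases hF : F (e s) = ∞
  · have := hP0 _ hF
    simp only [R, R₂, if_pos hF]
    field_simp
  · have hKs := hK0 _ (param_mem s) hF
    have hQs : Q (e s) ≠ 0 := by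
      intro h
      have h3 := hKfac _ (param_mem s) hF
      change _ = Q (e s) * _ at h3
      rw [h, zero_mul, sub_eq_zero] at h3
      exact hb s (by rw [← coe_toComplex hF, h3])
    simp only [R, R₁, if_neg hF]
    rw [hmq _ (param_mem s) hF]
    field_simp

end IsDiskMap

/-! ### Multiplicity and the derivative -/

namespace IsFiber

variable {e : ℂ → ℂ} {F : ℂ → RiemannSphere} {w : ℂ} {M : Multiset ℂ}

/-- Differentiating `(z - a) * (rest) + w` at `a` leaves the rest at `a`, which vanishes exactly
when `a` is a repeated solution. -/
theorem exists_hasDerivAt_of_cons (H : IsDiskMap e F) {a : ℂ} (hM : IsFiber e F w (a ::ₘ M)) :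
    ∃ g : ℂ, g ≠ 0 ∧ HasDerivAt (fun z => toComplex (F z)) ((M.map (a - ·)).prod * g) a := by
  have haO := hM.mem_image (Multiset.mem_cons_self a M)
  obtain ⟨G, -, -, hG, hG0, hfac⟩ := hM
  have haK := IsDiskMap.image_ball_subset haO
  refine ⟨G a, hG0 a haK (H.ne_infty a haO), ?_⟩
  have hev : (fun z => toComplex (F z)) =ᶠ[𝓝 a]
      fun z => (z - a) * ((M.map (z - ·)).prod * G z) + w := by
    filter_upwards [H.isOpen_image.mem_nhds haO] with z hz
    rw [← mul_assoc, ← Multiset.prod_cons, ← Multiset.map_cons,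
      ← hfac z (IsDiskMap.image_ball_subset hz) (H.ne_infty z hz), sub_add_cancel]
  refine HasDerivAt.congr_of_eventuallyEq ?_ hev
  have hprod : Differentiable ℂ fun z : ℂ => (M.map (z - ·)).prod := by
    clear hfac hev
    induction M using Multiset.induction with
    | empty => simp
    | cons b M ih =>
      simp only [Multiset.map_cons, Multiset.prod_cons]
      exact Differentiable.fun_mul (by fun_prop) ih
  have h1 := (hprod a).mul (hG.differentiableAt (H.isOpen_image.mem_nhds haO))
  have h2 := (((hasDerivAt_id a).sub_const a).mul h1.hasDerivAt).add_const w
  simpa using h2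

theorem deriv_ne_zero (H : IsDiskMap e F) {a : ℂ} (hM : IsFiber e F w {a}) :
    deriv (fun z => toComplex (F z)) a ≠ 0 := by
  obtain ⟨g, hg, hd⟩ := exists_hasDerivAt_of_cons (M := 0) H hM
  rw [hd.deriv]
  simpa using hg

theorem deriv_eq_zero (H : IsDiskMap e F) {a : ℂ} (hM : IsFiber e F w (a ::ₘ M)) (ha : a ∈ M) :
    deriv (fun z => toComplex (F z)) a = 0 := by
  obtain ⟨g, -, hd⟩ := exists_hasDerivAt_of_cons H hM
  rw [hd.deriv, multiset_prod_sub_eq_zero.2 ha, zero_mul]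

end IsFiber

/-! ### Counting preimages of points inside and outside `V` -/

theorem IsJordanParametrization.isClosedEmbedding {γ : Circle → RiemannSphere}
    {J : Set RiemannSphere} (h : IsJordanParametrization γ J) : Topology.IsClosedEmbedding γ :=
  h.1.isClosedEmbedding h.2.1

theorem IsJordanParametrization.exists_homeomorph {γ γ' : Circle → RiemannSphere}
    {J : Set RiemannSphere} (h : IsJordanParametrization γ J)
    (h' : IsJordanParametrization γ' J) : ∃ σ : Circle ≃ₜ Circle, ∀ s, γ s = γ' (σ s) := by
  let e := h.isClosedEmbedding.isEmbedding.toHomeomorph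
  let e' := h'.isClosedEmbedding.isEmbedding.toHomeomorph
  let c : range γ ≃ₜ range γ' := Homeomorph.setCongr (h.2.2.trans h'.2.2.symm)
  refine ⟨(e.trans c).trans e'.symm, fun s => ?_⟩
  have h1 : e' (e'.symm (c (e s))) = c (e s) := e'.apply_symm_apply _
  exact (congrArg Subtype.val h1).symm

namespace IsDiskMap

variable {e : ℂ → ℂ} {F : ℂ → RiemannSphere} {V : Set RiemannSphere} {h : ℂ → RiemannSphere}

theorem ne_of_notMem_frontier (hJ : IsJordanParametrization (fun s : Circle => F (e s)) (frontier V))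
    {w : RiemannSphere} (hw : w ∉ frontier V) (s : Circle) : F (e s) ≠ w := fun hs =>
  hw (hJ.2.2 ▸ ⟨s, hs⟩)

/-- The boundary values are those of `h` after a circle homeomorphism of degree `m = ±1`, so the
count is `m` inside and `0` outside. As the count is a natural number, `m = 1` inside, and no
orientation hypothesis on `F` is required. -/
theorem card_fiber_of_infty_notMem (H : IsDiskMap e F) (HV : IsDiskParam h V)
    (hl : LiesOnLeft V (fun s : Circle => h s)) (hV : ∞ ∉ V)
    (hJ : IsJordanParametrization (fun s : Circle => F (e s)) (frontier V)) {w : ℂ}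
    {M : Multiset ℂ} (hM : IsFiber e F w M) :
    ((w : RiemannSphere) ∈ interior V → M.card = 1) ∧ ((w : RiemannSphere) ∉ V → M.card = 0) := by
  have hVc : IsClosed V := HV.isCompact.isClosed
  have hfin := ne_of_notMem_frontier hJ (w := ∞) fun hF => hV (hVc.frontier_subset hF)
  have hd := H.hasDegree_sub hM hfin
  obtain ⟨σ, hσ⟩ := hJ.exists_homeomorph HV.isJordanParametrization
  obtain ⟨m, hm, hσm⟩ := hasDegree_homeomorph σ
  constructor
  · intro hw
    have h1 := (hl.hasDegree_planeChart HV hw hV).comp (σ := σ) σ.continuous hσm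
    have h2 := hd.unique (h1.congr fun s => by
      rw [hσ s, planeChart_infty, planeChart_infty, toComplex_coe])
    omega
  · intro hw
    have h1 := (HV.hasDegree_moebiusQuotient_of_notMem hw hV).comp (σ := σ) σ.continuous hσm
    have h2 := hd.unique (h1.congr fun s => by
      rw [← hσ s, moebiusQuotient, diffOrOne_infty_right, div_one]
      conv_rhs => rw [← coe_toComplex (hfin s), diffOrOne_coe])
    omega

/-- The winding number gives only that counts inside exceed counts outside by `1`. Injectivity near
the boundary point over `∞` shows that the count outside is `0`. -/
theorem card_fiber_of_infty_mem (H : IsDiskMap e F) (HV : IsDiskParam h V)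
    (hVfin : ∞ ∉ interior V) (hVinf : ∞ ∈ frontier V)
    (hl : LiesOnLeft V (fun s : Circle => F (e s)))
    (hinj : ∀ s : Circle, F (e s) = ∞ → ∃ N ∈ 𝓝 (e s), InjOn F (N ∩ e '' closedBall 0 1)) {w : ℂ}
    {M : Multiset ℂ} (hM : IsFiber e F w M) :
    ((w : RiemannSphere) ∈ interior V → M.card = 1) ∧ ((w : RiemannSphere) ∉ V → M.card = 0) := by
  have hJ := hl.1
  have hVc : IsClosed V := HV.isCompact.isClosed
  have hbne : ∀ {b : RiemannSphere}, b ∉ V → ∀ s : Circle, F (e s) ≠ b := fun hb =>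
    ne_of_notMem_frontier hJ fun hF => hb (hVc.frontier_subset hF)
  have hwne : ∀ {w : RiemannSphere}, w ∈ interior V → ∀ s : Circle, F (e s) ≠ w := fun hw =>
    ne_of_notMem_frontier hJ fun hF => hF.2 hw
  have hdiff : ∀ {w b : ℂ} {M N : Multiset ℂ}, (w : RiemannSphere) ∈ interior V →
      (b : RiemannSphere) ∉ V → IsFiber e F w M → IsFiber e F b N → (M.card : ℤ) = 1 + N.card :=
    fun hw hb hM hN => H.hasDegree_moebiusQuotient hM hN (hbne hb) (hl.2 _ hw _ hb).hasDegree
  obtain ⟨s₀, hs₀⟩ : ∃ s : Circle, F (e s) = ∞ := by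
    rw [← hJ.2.2] at hVinf
    exact hVinf
  obtain ⟨N, hN, hNinj⟩ := hinj s₀ hs₀
  have hCc : IsCompact (e '' closedBall 0 1 \ interior N) := H.isCompact.diff isOpen_interior
  have hFC : IsClosed (F '' (e '' closedBall 0 1 \ interior N)) :=
    (hCc.image_of_continuousOn (H.continuousOn.mono sdiff_subset)).isClosed
  have hinfC : ∞ ∉ F '' (e '' closedBall 0 1 \ interior N) := by
    rintro ⟨z, ⟨hz, hzN⟩, hzF⟩
    rcases mem_ball_or z hz with hzO | ⟨s, rfl⟩
    · exact H.ne_infty z hzO hzF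
    · rw [H.injective (hzF.trans hs₀.symm)] at hzN
      exact hzN (mem_interior_iff_mem_nhds.2 hN)
  -- The values in `int V` attained only inside `N`. This set is open, and it is nonempty because
  -- `∞` is in the closure of `int V` but not in the compact image of the complement of `int N`.
  set Ω := interior V ∩ (F '' (e '' closedBall 0 1 \ interior N))ᶜ with hΩ
  have hΩo : IsOpen Ω := isOpen_interior.inter hFC.isOpen_compl
  have hcl : ∞ ∈ closure (interior V) := by
    rw [HV.frontier_eq] at hVinf
    obtain ⟨x, hx, hxi⟩ := hVinf
    have h1 := (HV.continuousOn.mono (closure_ball (0 : ℂ) one_ne_zero).subset).image_closure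
    rw [HV.interior_eq, ← hxi]
    refine h1 ⟨x, ?_, rfl⟩
    rw [closure_ball _ one_ne_zero]
    exact sphere_subset_closedBall hx
  obtain ⟨p, hpC, hpV⟩ := mem_closure_iff.1 hcl _ hFC.isOpen_compl hinfC
  have hpΩ : p ∈ Ω := ⟨hpV, hpC⟩
  have hΩfin : ∀ {p}, p ∈ Ω → p ≠ ∞ := fun hp hpi => hVfin (hpi ▸ hp.1)
  have hsingle : ∀ {w : ℂ} {M : Multiset ℂ}, (w : RiemannSphere) ∈ Ω → IsFiber e F w M →
      ∀ a ∈ M, ∀ a' ∈ M, a = a' := by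
    intro w M hw hM a ha a' ha'
    have key : ∀ b ∈ M, F b = w ∧ b ∈ N ∩ e '' closedBall 0 1 := by
      intro b hb
      have hbO := hM.mem_image hb
      have hbK := image_ball_subset hbO
      have hFb : F b = w := (hM.mem_iff hbK (H.ne_infty b hbO)).1 hb
      refine ⟨hFb, ?_, hbK⟩
      by_contra hbN
      exact hw.2 ⟨b, ⟨hbK, fun hi => hbN (interior_subset hi)⟩, hFb⟩
    exact hNinj (key a ha).2 (key a' ha').2 ((key a ha).1.trans (key a' ha').1.symm)
  have hzero : ∀ {b : ℂ} {L : Multiset ℂ}, (b : RiemannSphere) ∉ V → IsFiber e F b L →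
      L.card = 0 := by
    intro b L hb hL
    by_contra hcard
    -- A positive count over `b` forces a count of at least `2` over `Ω`, whose fibers have a single
    -- point; that point is then repeated.
    have hcons : ∀ {w : ℂ} {M : Multiset ℂ}, (w : RiemannSphere) ∈ Ω → IsFiber e F w M →
        ∀ a ∈ M, ∃ M', M = a ::ₘ M' ∧ a ∈ M' := by
      intro w M hw hM a ha
      obtain ⟨M', rfl⟩ := Multiset.exists_cons_of_mem ha
      have h1 := hdiff hw.1 hb hM hL
      rw [Multiset.card_cons] at h1
      obtain ⟨a', ha'⟩ := Multiset.card_pos_iff_exists_mem.1 (show 0 < M'.card by omega)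
      refine ⟨M', rfl, ?_⟩
      rwa [hsingle hw hM a ha a' (Multiset.mem_cons_of_mem ha')]
    have hderiv : ∀ z ∈ e '' ball 0 1, F z ∈ Ω → deriv (fun z => toComplex (F z)) z = 0 := by
      intro z hz hzΩ
      have hzi := H.ne_infty z hz
      rw [← coe_toComplex hzi] at hzΩ
      obtain ⟨M, hM⟩ := H.exists_isFiber (hwne hzΩ.1)
      have hzM : z ∈ M := (hM.mem_iff (image_ball_subset hz) hzi).2 (coe_toComplex hzi).symm
      obtain ⟨M', rfl, hzM'⟩ := hcons hzΩ hM z hzM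
      exact hM.deriv_eq_zero H hzM'
    obtain ⟨z, hz, hzΩ⟩ : ∃ z ∈ e '' ball 0 1, F z ∈ Ω := by
      have hpi := hΩfin hpΩ
      rw [← coe_toComplex hpi] at hpΩ
      obtain ⟨M, hM⟩ := H.exists_isFiber (hwne hpΩ.1)
      have h1 := hdiff hpΩ.1 hb hM hL
      obtain ⟨z, hz⟩ := Multiset.card_pos_iff_exists_mem.1 (show 0 < M.card by omega)
      have hzO := hM.mem_image hz
      refine ⟨z, hzO, ?_⟩
      rwa [(hM.mem_iff (image_ball_subset hzO) (H.ne_infty z hzO)).1 hz]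
    have hFz : ContinuousAt F z := (H.continuousOn z (image_ball_subset hz)).continuousAt
      (mem_of_superset (H.isOpen_image.mem_nhds hz) image_ball_subset)
    obtain ⟨r, hr, hball⟩ := Metric.mem_nhds_iff.1
      (inter_mem (H.isOpen_image.mem_nhds hz) (hFz.preimage_mem_nhds (hΩo.mem_nhds hzΩ)))
    refine H.not_eventually_eq hz (toComplex (F z)) ?_
    filter_upwards [ball_mem_nhds z hr] with y hy
    rw [sub_eq_zero]
    exact isOpen_ball.is_const_of_deriv_eq_zero (convex_ball z r).isPreconnected
      (H.differentiableOn.mono fun x hx => (hball hx).1)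
      (fun x hx => hderiv x (hball hx).1 (hball hx).2) hy (mem_ball_self hr)
  refine ⟨fun hw => ?_, fun hw => hzero hw hM⟩
  obtain ⟨b, hb⟩ := HV.exists_notMem
  have hbi : b ≠ ∞ := fun hbi => hb (hVc.frontier_subset (hbi ▸ hVinf))
  rw [← coe_toComplex hbi] at hb
  obtain ⟨L, hL⟩ := H.exists_isFiber (hbne hb)
  have h1 := hdiff hw hb hM hL
  have h2 := hzero hb hL
  omega

/-- If the fibers of `F` have one element over the interior of `V` and none outside `V`, then `F`
is bijective and conformal in the interior. -/
theorem bijOn_of_card (H : IsDiskMap e F) (HV : IsDiskParam h V) (hVfin : ∞ ∉ interior V)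
    (hJ : IsJordanParametrization (fun s : Circle => F (e s)) (frontier V))
    (hcard : ∀ {w : ℂ} {M : Multiset ℂ}, IsFiber e F w M →
      ((w : RiemannSphere) ∈ interior V → M.card = 1) ∧
        ((w : RiemannSphere) ∉ V → M.card = 0)) :
    BijOn F (e '' ball 0 1) (interior V) ∧
      ∀ z ∈ e '' ball 0 1, deriv (fun z => toComplex (F z)) z ≠ 0 := by
  have hVc : IsClosed V := HV.isCompact.isClosed
  have hwne : ∀ {w : RiemannSphere}, w ∈ interior V → ∀ s : Circle, F (e s) ≠ w := fun hw =>
    ne_of_notMem_frontier hJ fun hF => hF.2 hw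
  have hV : ∀ z ∈ e '' ball 0 1, F z ∈ V := by
    intro z hz
    by_contra hzV
    have hzi := H.ne_infty z hz
    rw [← coe_toComplex hzi] at hzV
    obtain ⟨M, hM⟩ := H.exists_isFiber
      (ne_of_notMem_frontier hJ fun hF => hzV (hVc.frontier_subset hF))
    have hzM : z ∈ M := (hM.mem_iff (image_ball_subset hz) hzi).2 (coe_toComplex hzi).symm
    exact absurd ((hcard hM).2 hzV) (Multiset.card_pos_iff_exists_mem.2 ⟨z, hzM⟩).ne'
  -- An open map with values in `V` has its values in the interior of `V`.
  have hmaps : MapsTo F (e '' ball 0 1) (interior V) := by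
    intro z hz
    rw [mem_interior_iff_mem_nhds]
    refine H.nhds_le_map hz (mem_map.2 ?_)
    filter_upwards [H.isOpen_image.mem_nhds hz] with y hy using hV y hy
  have hfib : ∀ z ∈ e '' ball 0 1, IsFiber e F (toComplex (F z)) {z} := by
    intro z hz
    have hzi := H.ne_infty z hz
    have hzV := hmaps hz
    rw [← coe_toComplex hzi] at hzV
    obtain ⟨M, hM⟩ := H.exists_isFiber (hwne hzV)
    have hzM : z ∈ M := (hM.mem_iff (image_ball_subset hz) hzi).2 (coe_toComplex hzi).symm
    obtain ⟨a, rfl⟩ := Multiset.card_eq_one.1 ((hcard hM).1 hzV)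
    rwa [← Multiset.mem_singleton.1 hzM] at hM
  refine ⟨⟨hmaps, ?_, ?_⟩, fun z hz => (hfib z hz).deriv_ne_zero H⟩
  · intro z hz y hy hzy
    have hy' := (hfib z hz).mem_iff (image_ball_subset hy) (H.ne_infty y hy)
    rw [coe_toComplex (H.ne_infty z hz)] at hy'
    exact (Multiset.mem_singleton.1 (hy'.2 hzy.symm)).symm
  · intro w hw
    have hwi : w ≠ ∞ := fun hwi => hVfin (hwi ▸ hw)
    rw [← coe_toComplex hwi] at hw ⊢
    obtain ⟨M, hM⟩ := H.exists_isFiber (hwne hw)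
    obtain ⟨a, rfl⟩ := Multiset.card_eq_one.1 ((hcard hM).1 hw)
    have haO := hM.mem_image (Multiset.mem_singleton_self a)
    exact ⟨a, haO, (hM.mem_iff (image_ball_subset haO) (H.ne_infty a haO)).1
      (Multiset.mem_singleton_self a)⟩

end IsDiskMap

/-! ### Holomorphy on the sphere in the charts `planeParam` -/

theorem switch_infty (p : RiemannSphere) : switch ∞ p = inversion p := by simp [switch]

theorem switch_coe (z : ℂ) (p : RiemannSphere) : switch z p = p := by simp [switch]

theorem switch_of_ne {q : RiemannSphere} (hq : q ≠ ∞) (p : RiemannSphere) : switch q p = p := by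
  simp [switch, hq]

theorem continuous_switch (q : RiemannSphere) : Continuous (switch q) := by
  by_cases hq : q = ∞
  · subst hq
    simpa [funext switch_infty] using continuous_inversion
  · exact continuous_id.congr fun p => (switch_of_ne hq p).symm

theorem switch_switch (q p : RiemannSphere) : switch q (switch q p) = p := by
  by_cases hq : q = ∞
  · subst hq
    rw [switch_infty, switch_infty, inversion_inversion]
  · rw [switch_of_ne hq, switch_of_ne hq]

theorem switch_self_ne_infty (q : RiemannSphere) : switch q q ≠ ∞ := by
  by_cases hq : q = ∞
  · subst hq
    rw [switch_infty, inversion_infty]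
    exact OnePoint.coe_ne_infty _
  · rwa [switch_of_ne hq]

/-- The change of charts from `planeParam b` to the standard chart is holomorphic. -/
theorem differentiableAt_switch_planeParam (b : RiemannSphere) (ζ : ℂ) :
    DifferentiableAt ℂ (fun z => toComplex (switch (planeParam b ζ) (planeParam b z))) ζ := by
  induction b using OnePoint.rec with
  | infty =>
    simp only [planeParam_infty, switch_coe, toComplex_coe]
    exact differentiableAt_id
  | coe w =>
    by_cases hζ : ζ = 0
    · subst hζ
      -- This is `1 / (z⁻¹ + w)` with its removable singularity at `0` filled in.
      have hd : DifferentiableAt ℂ (fun z : ℂ => z / (1 + w * z)) 0 :=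
        DifferentiableAt.div (by fun_prop) (by fun_prop) (by simp)
      refine hd.congr_of_eventuallyEq ?_
      have hev : ∀ᶠ z : ℂ in 𝓝 0, 1 + w * z ≠ 0 :=
        (Continuous.continuousAt (by fun_prop)).eventually_ne (by simp)
      filter_upwards [hev] with z hz
      rw [planeParam_coe_zero, switch_infty]
      by_cases hz0 : z = 0
      · rw [hz0, planeParam_coe_zero, inversion_infty, toComplex_coe]
        simp
      · have h1 : z⁻¹ + w ≠ 0 := by
          intro h
          apply hz
          field_simp at h
          linear_combination h
        rw [planeParam_coe w hz0, inversion_coe h1, toComplex_coe]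
        field_simp
    · have hd : DifferentiableAt ℂ (fun z : ℂ => z⁻¹ + w) ζ :=
        (differentiableAt_inv hζ).add_const w
      refine hd.congr_of_eventuallyEq ?_
      filter_upwards [isOpen_ne.mem_nhds hζ] with z hz
      rw [planeParam_coe w hζ, switch_coe, planeParam_coe w hz, toComplex_coe]

theorem HolomorphicAt.differentiableAt_planeParam {f : RiemannSphere → RiemannSphere}
    {b : RiemannSphere} {ζ : ℂ} (hf : HolomorphicAt f (planeParam b ζ))
    (hfin : f (planeParam b ζ) ≠ ∞) :
    DifferentiableAt ℂ (fun z => toComplex (f (planeParam b z))) ζ := by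
  have h1 := hf.2
  simp only [switch_of_ne hfin] at h1
  have h2 := h1.comp ζ (f := fun z => toComplex (switch (planeParam b ζ) (planeParam b z)))
    (differentiableAt_switch_planeParam b ζ)
  refine h2.congr_of_eventuallyEq ?_
  have hc : ContinuousAt (fun z => switch (planeParam b ζ) (planeParam b z)) ζ :=
    ((continuous_switch _).comp (isOpenEmbedding_planeParam b).continuous).continuousAt
  filter_upwards [hc.eventually_ne (switch_self_ne_infty _)] with z hz
  rw [Function.comp_apply, coe_toComplex hz, switch_switch]

theorem holomorphicAt_of_planeParam {g : RiemannSphere → RiemannSphere} {b w : RiemannSphere}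
    {G : ℂ → ℂ} (hw : w ≠ ∞) (hg : ContinuousAt g w) (hG : DifferentiableAt ℂ G (toComplex w))
    (hgG : ∀ᶠ z : ℂ in 𝓝 (toComplex w), g (z : RiemannSphere) = planeParam b (G z)) :
    HolomorphicAt g w := by
  refine ⟨hg, ?_⟩
  simp only [switch_of_ne hw]
  have h0 : g w = planeParam b (G (toComplex w)) := by
    rw [← hgG.self_of_nhds, coe_toComplex hw]
  have h1 := (differentiableAt_switch_planeParam b (G (toComplex w))).comp (toComplex w) hG
  refine h1.congr_of_eventuallyEq ?_
  filter_upwards [hgG] with z hz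
  rw [Function.comp_apply, hz, h0]

/-- A continuous map that restricts to a bijection of the compact set `A` onto `B` restricts to a
homeomorphism. -/
theorem restrictsToHomeomorph_of_bijOn {f : RiemannSphere → RiemannSphere}
    {A B : Set RiemannSphere} (hA : IsCompact A) (hf : ContinuousOn f A) (hb : BijOn f A B) :
    RestrictsToHomeomorph f A B := by
  have := isCompact_iff_compactSpace.1 hA
  have hc : Continuous fun z : A => (⟨f z, hb.mapsTo z.2⟩ : B) :=
    (continuousOn_iff_continuous_domRestrict.1 hf).subtype_mk _
  exact ⟨Continuous.homeoOfEquivCompactToT2 (f := hb.equiv f) hc, fun z => rfl⟩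

end RiemannSphere

/-! ### The theorem -/

open RiemannSphere Metric Set Filter in
theorem proposition11 (U V : Set RiemannSphere) (f : RiemannSphere → RiemannSphere)
    (hU : RiemannSphere.IsClosedJordanRegion U)
    (hV : RiemannSphere.IsClosedJordanRegion V)
    (hVfin : ∞ ∉ interior V)
    (hfin : ∀ z ∈ interior U, f z ≠ ∞)
    (hhol : RiemannSphere.HolomorphicOn f (interior U))
    (hcont : ContinuousOn f U)
    (hbdry : RiemannSphere.RestrictsToHomeomorph f (frontier U) (frontier V))
    (hinj : ∞ ∈ frontier V →
      ∀ z₀ ∈ frontier U, f z₀ = ∞ → ∃ N ∈ 𝓝 z₀, Set.InjOn f (N ∩ U))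
    (horient : ∞ ∈ frontier V →
      ∀ γ : Circle → RiemannSphere,
        RiemannSphere.LiesOnLeft U γ → RiemannSphere.LiesOnLeft V (f ∘ γ)) :
    RiemannSphere.RestrictsToHomeomorph f U V ∧
      RiemannSphere.RestrictsToBiholomorphism f (interior U) (interior V) := by
  obtain ⟨k, HU, hlU⟩ := hU.exists_oriented
  obtain ⟨h, HV, hlV⟩ := hV.exists_oriented
  -- Only the source needs a new coordinate: `U` may contain `∞`, whereas `f` is finite on `int U`
  -- and `int V` lies in `ℂ`.
  obtain ⟨b, hb⟩ := HU.exists_notMem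
  have hUc : IsClosed U := HU.isCompact.isClosed
  have hVc : IsClosed V := HV.isCompact.isClosed
  have hbU : ∀ {p}, p ∈ U → p ≠ b := fun hp => ne_of_mem_of_not_mem hp hb
  have hK : (fun z => planeChart b (k z)) '' closedBall 0 1 = planeParam b ⁻¹' U :=
    (HU.preimage_planeParam hb).symm
  have hO : (fun z => planeChart b (k z)) '' ball 0 1 = planeParam b ⁻¹' interior U := by
    rw [HU.interior_eq]
    ext z
    constructor
    · rintro ⟨x, hx, rfl⟩
      exact ⟨x, hx, (planeParam_planeChart (hbU (HU.mem (ball_subset_closedBall hx)))).symm⟩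
    · rintro ⟨x, hx, hxz⟩
      exact ⟨x, hx, (congrArg _ hxz).trans (planeChart_planeParam b z)⟩
  have hke : ∀ s : Circle, planeParam b (planeChart b (k s)) = k s := fun s =>
    planeParam_planeChart (hbU (HU.mem (coe_circle_mem s)))
  have hkJ := HU.isJordanParametrization
  have hkf : ∀ s : Circle, k s ∈ frontier U := fun s => hkJ.2.2 ▸ ⟨s, rfl⟩
  obtain ⟨φ, hφ⟩ := hbdry
  have hfJ : IsJordanParametrization (fun s : Circle => f (k s)) (frontier V) := by
    refine ⟨hcont.comp_continuous hkJ.1 fun s => HU.mem (coe_circle_mem s), ?_, ?_⟩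
    · intro s t hst
      have h1 : φ ⟨k s, hkf s⟩ = φ ⟨k t, hkf t⟩ := Subtype.ext (by rw [hφ, hφ]; exact hst)
      exact hkJ.2.1 (congrArg Subtype.val (φ.injective h1))
    · ext p
      constructor
      · rintro ⟨s, rfl⟩
        have h1 := (φ ⟨k s, hkf s⟩).2
        rwa [hφ] at h1
      · intro hp
        obtain ⟨⟨z, hz⟩, hzp⟩ := φ.surjective ⟨p, hp⟩
        have hz' := hz
        rw [← hkJ.2.2] at hz'
        obtain ⟨s, rfl⟩ := hz'
        exact ⟨s, (hφ ⟨_, hz⟩).symm.trans (congrArg Subtype.val hzp)⟩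
  have hDM : IsDiskMap (fun z => planeChart b (k z)) (fun z => f (planeParam b z)) := by
    refine ⟨HU.continuousOn_planeChart hb, HU.injOn_planeChart hb, ?_, ?_, ?_, ?_, ?_, ?_⟩
    · intro p hp
      refine hlU.hasDegree_planeChart HU ?_ hb
      rw [HU.interior_eq]
      exact ⟨p, hp, rfl⟩
    · rw [hO]
      exact isOpen_interior.preimage (isOpenEmbedding_planeParam b).continuous
    · rw [hK]
      exact hcont.comp (isOpenEmbedding_planeParam b).continuous.continuousOn (mapsTo_preimage _ _)
    · rw [hO]
      exact fun z hz => hfin _ hz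
    · rw [hO]
      exact fun z hz => ((hhol _ hz).differentiableAt_planeParam
        (hfin _ hz)).differentiableWithinAt
    · simpa only [hke] using hfJ.2.1
  have hJ : IsJordanParametrization
      (fun s : Circle => f (planeParam b (planeChart b (k s)))) (frontier V) := by
    simpa only [hke] using hfJ
  obtain ⟨hbij, hderiv⟩ := hDM.bijOn_of_card HV hVfin hJ fun hM => by
    by_cases hVinf : ∞ ∈ V
    · have hVfr : ∞ ∈ frontier V := hVc.frontier_eq ▸ ⟨hVinf, hVfin⟩
      refine hDM.card_fiber_of_infty_mem HV hVfin hVfr ?_ ?_ hM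
      · have := horient hVfr _ hlU
        simpa only [Function.comp_def, hke] using this
      · intro s hs
        rw [hke] at hs
        obtain ⟨N, hN, hNi⟩ := hinj hVfr (k s) (hkf s) hs
        refine ⟨planeParam b ⁻¹' N, (isOpenEmbedding_planeParam b).continuous.continuousAt
          |>.preimage_mem_nhds (by rwa [hke]), ?_⟩
        rw [hK]
        exact fun z hz w hw hzw => (isOpenEmbedding_planeParam b).injective (hNi hz hw hzw)
    · exact hDM.card_fiber_of_infty_notMem HV hlV hVinf hJ hM
  have hintU : BijOn (planeParam b) (planeParam b ⁻¹' interior U) (interior U) :=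
    ⟨mapsTo_preimage _ _, (isOpenEmbedding_planeParam b).injective.injOn, fun p hp =>
      ⟨planeChart b p, by
        rwa [mem_preimage, planeParam_planeChart (hbU (interior_subset hp))],
        planeParam_planeChart (hbU (interior_subset hp))⟩⟩
  rw [hO] at hbij hderiv
  have hint : BijOn f (interior U) (interior V) := by
    refine ⟨fun p hp => ?_, fun p hp q hq hpq => ?_, fun w hw => ?_⟩
    · obtain ⟨z, hz, rfl⟩ := hintU.surjOn hp
      exact hbij.mapsTo hz
    · obtain ⟨z, hz, rfl⟩ := hintU.surjOn hp
      obtain ⟨y, hy, rfl⟩ := hintU.surjOn hq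
      exact congrArg _ (hbij.injOn hz hy hpq)
    · obtain ⟨z, hz, rfl⟩ := hbij.surjOn hw
      exact ⟨_, hz, rfl⟩
  have hfr : BijOn f (frontier U) (frontier V) := by
    refine ⟨fun p hp => hφ ⟨p, hp⟩ ▸ (φ ⟨p, hp⟩).2, fun p hp q hq hpq => ?_, fun w hw => ?_⟩
    · have h1 : φ ⟨p, hp⟩ = φ ⟨q, hq⟩ := Subtype.ext (by rw [hφ, hφ]; exact hpq)
      exact congrArg Subtype.val (φ.injective h1)
    · obtain ⟨z, hz⟩ := φ.surjective ⟨w, hw⟩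
      exact ⟨z, z.2, (hφ z).symm.trans (congrArg Subtype.val hz)⟩
  have hall : BijOn f U V := by
    have hu : interior U ∪ frontier U = U := by
      rw [← closure_eq_interior_union_frontier, hUc.closure_eq]
    have hv : interior V ∪ frontier V = V := by
      rw [← closure_eq_interior_union_frontier, hVc.closure_eq]
    have := hint.union hfr ((injOn_union disjoint_interior_frontier).2
      ⟨hint.injOn, hfr.injOn, fun p hp q hq hpq =>
        (disjoint_interior_frontier (s := V)).le_bot
          ⟨hint.mapsTo hp, hpq ▸ hfr.mapsTo hq⟩⟩)
    rwa [hu, hv] at this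
  refine ⟨restrictsToHomeomorph_of_bijOn HU.isCompact hcont hall, hhol, hint,
    Function.invFunOn f U, ⟨fun p hp => hall.injOn.leftInvOn_invFunOn (interior_subset hp),
      fun w hw => Function.invFunOn_eq (hall.surjOn (interior_subset hw))⟩, ?_⟩
  intro w hw
  set g := Function.invFunOn f U with hg
  have hwi : w ≠ ∞ := fun hwi => hVfin (hwi ▸ hw)
  have hfg : ∀ v ∈ V, f (g v) = v := fun v hv => Function.invFunOn_eq (hall.surjOn hv)
  have hgU : ∀ v ∈ V, g v ∈ U := fun v hv => Function.invFunOn_mem (hall.surjOn hv)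
  have hgf : ∀ p ∈ U, g (f p) = p := fun p hp => hall.injOn.leftInvOn_invFunOn hp
  have hgc : ContinuousAt g w := by
    have := continuousOn_invFunOn HU.isCompact hcont hall.injOn
    rw [hall.image_eq] at this
    exact this.continuousAt (mem_interior_iff_mem_nhds.1 hw)
  have hgint : g w ∈ interior U := by
    obtain ⟨p, hp, rfl⟩ := hint.surjOn hw
    rwa [hgf p (interior_subset hp)]
  have hgw : planeParam b (planeChart b (g w)) = g w :=
    planeParam_planeChart (hbU (interior_subset hgint))
  have hev : ∀ᶠ z : ℂ in 𝓝 (toComplex w), (z : RiemannSphere) ∈ V := by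
    refine OnePoint.continuous_coe.continuousAt.eventually_mem ?_
    rw [coe_toComplex hwi]
    exact mem_interior_iff_mem_nhds.1 hw
  refine holomorphicAt_of_planeParam (b := b) (G := fun z => planeChart b (g z)) hwi hgc ?_ ?_
  · have hmem : planeChart b (g w) ∈ planeParam b ⁻¹' interior U := by
      rwa [mem_preimage, hgw]
    have hG : ContinuousAt (fun z : ℂ => planeChart b (g z)) (toComplex w) := by
      have h1 : ContinuousAt (fun v => planeChart b (g v)) w :=
        (continuousAt_planeChart (hbU (interior_subset hgint))).tendsto.comp hgc
      rw [← coe_toComplex hwi] at h1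
      exact OnePoint.continuousAt_coe.1 h1
    have hd : HasDerivAt (fun z => toComplex (f (planeParam b z)))
        (deriv (fun z => toComplex (f (planeParam b z))) (planeChart b (g w)))
        (planeChart b (g (toComplex w : RiemannSphere))) := by
      rw [coe_toComplex hwi]
      exact (hDM.differentiableAt (hO ▸ hmem)).hasDerivAt
    -- A continuous local inverse of a function with nonzero derivative is differentiable.
    refine (hd.of_local_left_inverse hG (hderiv _ hmem) ?_).differentiableAt
    filter_upwards [hev] with z hz
    rw [planeParam_planeChart (hbU (hgU _ hz)), hfg _ hz, toComplex_coe]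
  · filter_upwards [hev] with z hz
    exact (planeParam_planeChart (hbU (hgU _ hz))).symm
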